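/- There are an algorithm, a function $f:\mathbb{N}^2\to\mathbb{N}$ and a constant $c$ such that the following holds. The input is an instance of Integer Quadratic Programming, that is, integers $n,m\ge 0$, a matrix $Q\in\mathbb{Z}^{n\times n}$, a matrix $A\in\mathbb{Z}^{m\times n}$ and a vector $b\in\mathbb{Z}^m$, and the problem is to minimize $x^TQx$ subject to $Ax\le b$, $x\in\mathbb{Z}^n$. Call $x\in\mathbb{Z}^n$ feasible if $Ax\le b$, call the instance unbounded if for every integer $\beta$ there is a feasible $x$ with $x^TQx\le\beta$, let $\alpha$ be the largest absolute value of an entry of $Q$ and $A$, and let $L$ be the total number of bits of the instance ($n$, $m$ and the entries of $Q$, $A$ and $b$, written in binary). On every instance the algorithm halts after time at most $f(n,\alpha)\cdot L^{c}$ and outputs a vector $x\in\mathbb{Z}^n$. If the instance has a feasible solution, then $x$ is feasible; if the instance has a feasible solution and is not unbounded, then $x$ is an optimal solution, that is, $x$ is feasible and $x^TQx\le y^TQy$ for every feasible $y\in\mathbb{Z}^n$. Here an algorithm is a program of a random access machine with integer registers and memory cells, and time is counted in bit operations: every step is charged according to the bit lengths of the numbers and addresses that it handles (logarithmic cost). 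-/

import Mathlib

/-! ## Integer Quadratic Programming -/

/-- An instance of Integer Quadratic Programming: minimize `xᵀ Q x` subject to `A x ≤ b`,
`x ∈ ℤⁿ`. -/
structure IQP where
  /-- the number of variables -/
  n : ℕ
  /-- the number of constraints -/
  m : ℕ
  /-- the matrix of the objective function -/
  Q : Matrix (Fin n) (Fin n) ℤ
  /-- the matrix of the constraints -/
  A : Matrix (Fin m) (Fin n) ℤ
  /-- the right-hand side of the constraints -/
  b : Fin m → ℤ

namespace IQP

/-- `x` satisfies `A x ≤ b` (entrywise). -/
def Feasible (I : IQP) (x : Fin I.n → ℤ) : Prop :=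
  I.A.mulVec x ≤ I.b

/-- The objective function `xᵀ Q x`. -/
def objective (I : IQP) (x : Fin I.n → ℤ) : ℤ :=
  x ⬝ᵥ I.Q.mulVec x

/-- For every integer `β` there is a feasible solution of value at most `β`. -/
def Unbounded (I : IQP) : Prop :=
  ∀ β : ℤ, ∃ x : Fin I.n → ℤ, I.Feasible x ∧ I.objective x ≤ β

/-- `x` is feasible and minimizes the objective function over all feasible solutions. -/
def IsOptimal (I : IQP) (x : Fin I.n → ℤ) : Prop :=
  I.Feasible x ∧ ∀ y : Fin I.n → ℤ, I.Feasible y → I.objective x ≤ I.objective y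

/-- The largest absolute value of an entry of `Q` and `A` (`0` if there are no entries). -/
def alpha (I : IQP) : ℕ :=
  max (Finset.univ.sup fun p : Fin I.n × Fin I.n => (I.Q p.1 p.2).natAbs)
    (Finset.univ.sup fun p : Fin I.m × Fin I.n => (I.A p.1 p.2).natAbs)

/-- The instance written as a sequence of integers: `n`, `m`, the entries of `Q` row by row,
the entries of `A` row by row, the entries of `b`. -/
def encode (I : IQP) : List ℤ :=
  [(I.n : ℤ), (I.m : ℤ)] ++ (List.ofFn fun i => List.ofFn (I.Q i)).flatten ++
    (List.ofFn fun i => List.ofFn (I.A i)).flatten ++ List.ofFn I.b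

end IQP

/-! ## Random access machines with logarithmic (bit) cost -/

namespace RAM

/-- The number of bits of an integer in binary, with one bit for the sign. -/
def bitLen (z : ℤ) : ℕ :=
  z.natAbs.size + 1

/-- The arithmetic operations of the machine. -/
inductive Op where
  | add
  | sub
  | mul
  | div

/-- The value of an arithmetic operation; `div` is division with remainder, rounded so that the
remainder is nonnegative, and a division by zero gives zero. -/
def Op.eval : Op → ℤ → ℤ → ℤ
  | .add, a, b => a + b
  | .sub, a, b => a - b
  | .mul, a, b => a * b
  | .div, a, b => a / b

/-- The cost of an arithmetic operation, that of the schoolbook methods on binary numbers. -/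
def Op.cost : Op → ℤ → ℤ → ℕ
  | .add, a, b => bitLen a + bitLen b
  | .sub, a, b => bitLen a + bitLen b
  | .mul, a, b => bitLen a * bitLen b
  | .div, a, b => bitLen a * bitLen b

/-- Programs. A program is a finite text, so that it names only finitely many registers and
constants. -/
inductive Prog where
  /-- do nothing -/
  | skip
  /-- `reg x := c` -/
  | const (x : ℕ) (c : ℤ)
  /-- `reg x := reg y o reg z` -/
  | arith (o : Op) (x y z : ℕ)
  /-- `reg x := mem (reg y)` -/
  | load (x y : ℕ)
  /-- `mem (reg x) := reg y` -/
  | store (x y : ℕ)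
  /-- first `P`, then `R` -/
  | seq (P R : Prog)
  /-- `P` if `0 < reg x`, otherwise `R` -/
  | cond (x : ℕ) (P R : Prog)
  /-- repeat `P` as long as `0 < reg x` -/
  | loop (x : ℕ) (P : Prog)

/-- A state of the machine: the contents of the registers and of the memory cells. -/
structure State where
  /-- the registers, named directly by the program -/
  reg : ℕ → ℤ
  /-- the memory, accessible through addresses that are held in registers -/
  mem : ℕ → ℤ

/-- The state in which `x` has been assigned to register `i`. -/
def State.setReg (s : State) (i : ℕ) (x : ℤ) : State :=
  { s with reg := Function.update s.reg i x }

/-- The state in which `x` has been written to memory cell `a`. -/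
def State.setMem (s : State) (a : ℕ) (x : ℤ) : State :=
  { s with mem := Function.update s.mem a x }

/-- The initial state: the input is in the memory cells `0, 1, 2, …`, everything else is zero. -/
def init (w : List ℤ) : State where
  reg := fun _ => 0
  mem := fun a => w.getD a 0

/-- `Exec P s s' t`: started in state `s`, the program `P` halts in state `s'` after time `t`.
The time is the sum of the costs of all executed steps, each of which is charged for the bits of
the numbers (addresses included) that it handles. An access to a negative address blocks the
program. -/
inductive Exec : Prog → State → State → ℕ → Prop where
  | skip (s : State) : Exec .skip s s 1
  | const (s : State) (x : ℕ) (c : ℤ) : Exec (.const x c) s (s.setReg x c) (bitLen c)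
  | arith (s : State) (o : Op) (x y z : ℕ) :
      Exec (.arith o x y z) s (s.setReg x (o.eval (s.reg y) (s.reg z)))
        (o.cost (s.reg y) (s.reg z))
  | load (s : State) (x y a : ℕ) (ha : s.reg y = a) :
      Exec (.load x y) s (s.setReg x (s.mem a)) (bitLen a + bitLen (s.mem a))
  | store (s : State) (x y a : ℕ) (ha : s.reg x = a) :
      Exec (.store x y) s (s.setMem a (s.reg y)) (bitLen a + bitLen (s.reg y))
  | seq {P R : Prog} {s s' s'' : State} {t t' : ℕ} (hP : Exec P s s' t) (hR : Exec R s' s'' t') :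
      Exec (.seq P R) s s'' (t + t')
  | cond_pos {x : ℕ} {P R : Prog} {s s' : State} {t : ℕ} (hx : 0 < s.reg x)
      (hP : Exec P s s' t) : Exec (.cond x P R) s s' (bitLen (s.reg x) + t)
  | cond_nonpos {x : ℕ} {P R : Prog} {s s' : State} {t : ℕ} (hx : s.reg x ≤ 0)
      (hR : Exec R s s' t) : Exec (.cond x P R) s s' (bitLen (s.reg x) + t)
  | loop_pos {x : ℕ} {P : Prog} {s s' s'' : State} {t t' : ℕ} (hx : 0 < s.reg x)
      (hP : Exec P s s' t) (hL : Exec (.loop x P) s' s'' t') :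
      Exec (.loop x P) s s'' (bitLen (s.reg x) + t + t')
  | loop_nonpos {x : ℕ} {P : Prog} {s : State} (hx : s.reg x ≤ 0) :
      Exec (.loop x P) s s (bitLen (s.reg x))

end RAM

/-- The length `L` of the bit-representation of an instance. -/
def IQP.size (I : IQP) : ℕ :=
  (I.encode.map RAM.bitLen).sum

open Matrix

/-! ## A bounded family of candidates that contains an optimal solution -/

section Candidates

-- The algorithm tries a list of candidates whose length depends only on `n` and `a = α²`.
-- Constraints with equal rows differ only in their right-hand sides, so `b` enters only through the
-- least right-hand side `T r` of each of the `(2a+1)^n` possible rows `r`.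
--
-- If a minimizer exists, then there is one whose coordinates all have the form `(∑ w r * T r + c) /
-- D`, with integers `w r`, `c`, `D` bounded in terms of `n` and `a`. To find it, carry along a
-- minimizer `x` and independent bounded linear forms whose values at `x` are bounded affine
-- combinations of the `T r`. While there are fewer than `n` forms, Siegel's lemma gives a short `y
-- ≠ 0` on which all of them vanish. If a constraint that varies along `y` is nearly tight at `x`,
-- its row is a new form. Otherwise `x + y` and `x - y` are feasible, and minimality gives
-- `|yᵀ(Q+Qᵀ)x| ≤ yᵀQy`. If `yᵀQy > 0`, the form `yᵀ(Q+Qᵀ)` is new and has a small value at `x`. If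
-- `yᵀQy = 0`, the objective is constant on the line `x + ℤy`, so `x` can slide until a constraint
-- is nearly tight or, if no constraint varies along `y`, until a coordinate is reduced modulo that
-- of `y`. The new form does not vanish at `y`, hence is independent of the old ones, whose values
-- survive the slide (`IsMinimizer.exists_represented`, `IsMinimizer.exists_independent`). Given `n`
-- forms, Siegel's lemma also solves for the coordinates (`exists_coordinate_representation`).
--
-- Feasibility is the case `Q = 0`, in which every feasible point is a minimizer; if the instance is
-- feasible and bounded, a minimizer exists because the values are integers.
--
-- For the running time, the algorithm is a nested term over the input cells. The predicate `Den`
-- says that a term has the right value and costs at most `U ^ deg`, where `U` bounds bit lengths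
-- and loop lengths and `deg` depends only on the text of the term. With `U` equal to a function of
-- `n`, `α` times `L`, this is the required bound; recomputing subterms only raises `deg`.

attribute [local instance] Matrix.seminormedAddCommGroup in
/-- Siegel's lemma with an integral bound. -/
theorem exists_int_kernel_vec {t n : ℕ} (h : t < n) (R : Fin t → Fin n → ℤ) (K : ℤ) (hK : 1 ≤ K)
    (hR : ∀ i j, |R i j| ≤ K) :
    ∃ y : Fin n → ℤ, y ≠ 0 ∧ (∀ i, R i ⬝ᵥ y = 0) ∧ ∀ j, |y j| ≤ (n * K) ^ t := by
  have hn : (1 : ℤ) ≤ n := by exact_mod_cast (show 1 ≤ n by omega)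
  have hnK : (1 : ℤ) ≤ n * K := by nlinarith
  -- The analytic form of Siegel's lemma needs at least one equation; without equations the all-ones
  -- vector serves.
  rcases Nat.eq_zero_or_pos t with rfl | ht
  · refine ⟨fun _ => 1, fun h0 => ?_, fun i => i.elim0, fun j => ?_⟩
    · simpa using congrFun h0 ⟨0, h⟩
    · simp
  obtain ⟨y, hy0, hy, hb⟩ := Int.Matrix.exists_ne_zero_int_vec_norm_le (Matrix.of R)
    (by simpa using h) (by simpa using ht)
  refine ⟨y, hy0, fun i => congrFun hy i, fun j => ?_⟩
  have h1 : ‖Matrix.of R‖ ≤ (K : ℝ) := by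
    rw [Matrix.norm_le_iff (by exact_mod_cast (by omega : (0 : ℤ) ≤ K))]
    intro i j
    rw [Int.norm_eq_abs]
    exact_mod_cast hR i j
  have hK' : (1 : ℝ) ≤ K := by exact_mod_cast hK
  have h2 : max 1 ‖Matrix.of R‖ ≤ (K : ℝ) := max_le hK' h1
  have h3 : (|y j| : ℝ) ≤ ‖y‖ := by
    rw [← Int.norm_eq_abs]
    exact norm_le_pi_norm y j
  have hn1 : (1 : ℝ) ≤ n := by exact_mod_cast hn
  have h4 : (1 : ℝ) ≤ n * max 1 ‖Matrix.of R‖ :=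
    one_le_mul_of_one_le_of_one_le hn1 (le_max_left _ _)
  simp only [Fintype.card_fin] at hb
  -- Siegel's exponent `t / (n - t)` is at most `t` because `n - t ≥ 1`; this gives an integral
  -- bound.
  have h5 : (t : ℝ) / (n - t) ≤ t := by
    have h6 : (t : ℝ) + 1 ≤ n := by exact_mod_cast h
    exact div_le_self (by positivity) (by linarith)
  have h7 : (|y j| : ℝ) ≤ (n * K) ^ t := by
    refine h3.trans (hb.trans ((Real.rpow_le_rpow_of_exponent_le h4 h5).trans ?_))
    rw [Real.rpow_natCast]
    gcongr
  exact_mod_cast h7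

theorem abs_dotProduct_le {n : ℕ} (u v : Fin n → ℤ) (p q : ℤ) (hp : ∀ i, |u i| ≤ p)
    (hq : ∀ i, |v i| ≤ q) : |u ⬝ᵥ v| ≤ n * (p * q) := by
  calc |u ⬝ᵥ v| ≤ ∑ i, |u i * v i| := Finset.abs_sum_le_sum_abs _ _
    _ ≤ ∑ _i : Fin n, p * q := by
        refine Finset.sum_le_sum fun i _ => ?_
        rw [abs_mul]
        exact mul_le_mul (hp i) (hq i) (abs_nonneg _) ((abs_nonneg _).trans (hp i))
    _ = n * (p * q) := by simp

/-- The linear form `ρ` takes at `x` a value that is an affine combination of the numbers `T r`,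
with all coefficients bounded by `K`. -/
def Represented {n R : ℕ} (T : Fin R → ℤ) (x : Fin n → ℤ) (K : ℤ) (ρ : Fin n → ℤ) : Prop :=
  (∀ j, |ρ j| ≤ K) ∧ ∃ (w : Fin R → ℤ) (c : ℤ), (∀ r, |w r| ≤ K) ∧ |c| ≤ K ∧
    ρ ⬝ᵥ x = ∑ r, w r * T r + c

theorem Represented.mono {n R : ℕ} {T : Fin R → ℤ} {x : Fin n → ℤ} {K K' : ℤ} {ρ : Fin n → ℤ}
    (h : Represented T x K ρ) (hK : K ≤ K') : Represented T x K' ρ := by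
  obtain ⟨h1, w, c, h2, h3, h4⟩ := h
  exact ⟨fun j => (h1 j).trans hK, w, c, fun r => (h2 r).trans hK, h3.trans hK, h4⟩

theorem Represented.of_abs_le {n R : ℕ} {T : Fin R → ℤ} {x : Fin n → ℤ} {K : ℤ} {ρ : Fin n → ℤ}
    (h1 : ∀ j, |ρ j| ≤ K) (h2 : |ρ ⬝ᵥ x| ≤ K) : Represented T x K ρ :=
  ⟨h1, 0, ρ ⬝ᵥ x, fun _ => by simpa using (abs_nonneg _).trans h2, h2, by simp⟩

variable {n m R : ℕ}

/-- `x` minimizes the quadratic form of `Q` under the constraints `A x ≤ b`. -/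
def IsMinimizer (Q : Matrix (Fin n) (Fin n) ℤ) (A : Matrix (Fin m) (Fin n) ℤ) (b : Fin m → ℤ)
    (x : Fin n → ℤ) : Prop :=
  A *ᵥ x ≤ b ∧ ∀ y, A *ᵥ y ≤ b → x ⬝ᵥ Q *ᵥ x ≤ y ⬝ᵥ Q *ᵥ y

/-- `Q` need not be symmetric, so the linear coefficient involves `Q + Qᵀ`. -/
theorem quadratic_add_smul (Q : Matrix (Fin n) (Fin n) ℤ) (x y : Fin n → ℤ) (l : ℤ) :
    (x + l • y) ⬝ᵥ Q *ᵥ (x + l • y) =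
      x ⬝ᵥ Q *ᵥ x + l * ((y ᵥ* (Q + Qᵀ)) ⬝ᵥ x) + l ^ 2 * (y ⬝ᵥ Q *ᵥ y) := by
  have h : (y ᵥ* (Q + Qᵀ)) ⬝ᵥ x = y ⬝ᵥ Q *ᵥ x + x ⬝ᵥ Q *ᵥ y := by
    rw [Matrix.vecMul_add, add_dotProduct, ← Matrix.dotProduct_mulVec, Matrix.vecMul_transpose,
      dotProduct_comm (Q *ᵥ y)]
  rw [h, Matrix.mulVec_add, Matrix.mulVec_smul]
  simp only [add_dotProduct, dotProduct_add, smul_dotProduct, dotProduct_smul, smul_eq_mul]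
  ring

theorem mulVec_add_smul_apply (A : Matrix (Fin m) (Fin n) ℤ) (x y : Fin n → ℤ) (l : ℤ)
    (i : Fin m) : (A *ᵥ (x + l • y)) i = (A *ᵥ x) i + l * (A *ᵥ y) i := by
  rw [Matrix.mulVec_add, Matrix.mulVec_smul]
  simp

/-! ### Gaining one form by moving a minimizer along a line -/

section Step

variable {Q : Matrix (Fin n) (Fin n) ℤ} {A : Matrix (Fin m) (Fin n) ℤ} {b : Fin m → ℤ}
  {T : Fin R → ℤ} {code : Fin m → Fin R} {a : ℤ}

/-- The value `(A x) i` lies below `T (code i)`, which lies below `b i`; near tightness therefore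
leaves a gap of at most `|(A y) i|`, which becomes the constant term. -/
theorem represented_of_near_boundary (hA : ∀ i j, |A i j| ≤ a) (hT : ∀ i, T (code i) ≤ b i)
    (hT' : ∀ x, A *ᵥ x ≤ b → ∀ i, (A *ᵥ x) i ≤ T (code i)) {x y : Fin n → ℤ} {K : ℤ}
    (hx : A *ᵥ x ≤ b) {i : Fin m} (hi : b i < (A *ᵥ x) i + |(A *ᵥ y) i|)
    (h1 : 1 ≤ K) (h2 : a ≤ K) (h3 : |(A *ᵥ y) i| ≤ K) : Represented T x K (A i) := by
  refine ⟨fun j => (hA i j).trans h2, Pi.single (code i) 1, (A *ᵥ x) i - T (code i), fun r => ?_,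
    ?_, ?_⟩
  · by_cases h : r = code i
    · subst h; simpa using h1
    · simp [Pi.single_eq_of_ne h]; omega
  · have := hT i
    have := hT' x hx i
    rw [abs_le]; constructor <;> omega
  · simp [Pi.single_apply, Matrix.mulVec]

/-- Constraint `i` eventually fails along `y`, so there is a last feasible multiple before the first
failure. A constraint violated one step later is within its own increment of being tight. -/
theorem exists_boundary (y : Fin n → ℤ) {x : Fin n → ℤ} (hx : A *ᵥ x ≤ b)
    {i : Fin m} (hi : 0 < (A *ᵥ y) i) :
    ∃ l : ℤ, A *ᵥ (x + l • y) ≤ b ∧ ∃ k, 0 < (A *ᵥ y) k ∧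
      b k < (A *ᵥ (x + l • y)) k + |(A *ᵥ y) k| := by
  have key : ∃ l : ℕ, A *ᵥ (x + (l : ℤ) • y) ≤ b ∧ ¬ A *ᵥ (x + ((l + 1 : ℕ) : ℤ) • y) ≤ b := by
    by_contra! hcon
    have hall : ∀ l : ℕ, A *ᵥ (x + (l : ℤ) • y) ≤ b := by
      intro l
      induction l with
      | zero => simpa using hx
      | succ l ih => exact hcon l ih
    have h1 := hall ((b i - (A *ᵥ x) i).toNat + 1) i
    rw [mulVec_add_smul_apply] at h1
    have h2 : (A *ᵥ x) i ≤ b i := hx i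
    push_cast at h1
    rw [Int.toNat_of_nonneg (by omega)] at h1
    nlinarith
  obtain ⟨l, h1, h2⟩ := key
  refine ⟨l, h1, ?_⟩
  rw [Pi.le_def] at h2
  push Not at h2
  obtain ⟨k, hk⟩ := h2
  have h3 := h1 k
  rw [mulVec_add_smul_apply] at hk h3
  push_cast at hk
  have h4 : 0 < (A *ᵥ y) k := by nlinarith
  refine ⟨k, h4, ?_⟩
  rw [mulVec_add_smul_apply, abs_of_pos h4]
  linarith

/-- This is the heart of the argument. The nonvanishing at `y` is what later makes the new form
independent, and `K` dominates all bounds that occur in the four cases. -/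
theorem IsMinimizer.exists_represented (hQ : ∀ i j, |Q i j| ≤ a) (hA : ∀ i j, |A i j| ≤ a)
    (hT : ∀ i, T (code i) ≤ b i)
    (hT' : ∀ x, A *ᵥ x ≤ b → ∀ i, (A *ᵥ x) i ≤ T (code i)) {x y : Fin n → ℤ}
    (hx : IsMinimizer Q A b x) (hy : y ≠ 0) {Y K : ℤ} (hyY : ∀ j, |y j| ≤ Y) (ha : 0 ≤ a)
    (hY : 1 ≤ Y) (hK : 4 * n ^ 2 * (a + 1) * Y ^ 2 ≤ K) :
    ∃ (l : ℤ) (ρ : Fin n → ℤ), IsMinimizer Q A b (x + l • y) ∧ ρ ⬝ᵥ y ≠ 0 ∧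
      Represented T (x + l • y) K ρ := by
  obtain ⟨k, hk⟩ : ∃ k, y k ≠ 0 := by
    by_contra! h
    exact hy (funext h)
  have hn : (1 : ℤ) ≤ n := by exact_mod_cast Fin.pos k
  have haY : 0 ≤ a * Y := by positivity
  have b1 : (1 : ℤ) ≤ n ^ 2 := one_le_pow₀ hn
  have b2 : Y ≤ Y ^ 2 := by nlinarith
  have b3 : (a + 1) * Y ≤ (a + 1) * Y ^ 2 := by gcongr
  have b4 : (a + 1) * Y ^ 2 ≤ n ^ 2 * ((a + 1) * Y ^ 2) := le_mul_of_one_le_left (by positivity) b1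
  have b5 : (n : ℤ) * (a * Y) ≤ n ^ 2 * ((a + 1) * Y ^ 2) :=
    mul_le_mul (by nlinarith) (by nlinarith) haY (by positivity)
  have b6 : (n : ℤ) * (n * (a * Y) * Y) ≤ n ^ 2 * ((a + 1) * Y ^ 2) := by
    have : (0 : ℤ) ≤ n ^ 2 * Y ^ 2 := by positivity
    nlinarith
  have hK' : 4 * (n ^ 2 * ((a + 1) * Y ^ 2)) ≤ K := by linarith
  have hAy : ∀ i, |(A *ᵥ y) i| ≤ K := fun i => by
    have := abs_dotProduct_le (A i) y a Y (hA i) hyY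
    refine this.trans ?_
    linarith
  have hK1 : 1 ≤ K := by nlinarith
  have haK : a ≤ K := by nlinarith
  have hYK : Y ≤ K := by nlinarith
  by_cases hnear : ∃ i, (A *ᵥ y) i ≠ 0 ∧ b i < (A *ᵥ x) i + |(A *ᵥ y) i|
  · obtain ⟨i, h1, h2⟩ := hnear
    refine ⟨0, A i, by simpa using hx, h1, ?_⟩
    simpa using represented_of_near_boundary hA hT hT' hx.1 h2 hK1 haK (hAy i)
  push Not at hnear
  have hfeas : ∀ l : ℤ, |l| ≤ 1 → A *ᵥ (x + l • y) ≤ b := by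
    intro l hl i
    rw [mulVec_add_smul_apply]
    by_cases h0 : (A *ᵥ y) i = 0
    · rw [h0]; simpa using hx.1 i
    · have h1 := hnear i h0
      have h2 : l * (A *ᵥ y) i ≤ |(A *ᵥ y) i| := by
        refine (le_abs_self _).trans ?_
        rw [abs_mul]
        exact mul_le_of_le_one_left (abs_nonneg _) hl
      linarith
  have hp := hx.2 _ (hfeas 1 (by norm_num))
  have hm := hx.2 _ (hfeas (-1) (by norm_num))
  rw [quadratic_add_smul] at hp hm
  have hq0 : 0 ≤ y ⬝ᵥ Q *ᵥ y := by linarith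
  -- The comparisons of `x` with `x + y` and with `x - y` bound the linear term from both sides by
  -- the quadratic one.
  have hs : |(y ᵥ* (Q + Qᵀ)) ⬝ᵥ x| ≤ y ⬝ᵥ Q *ᵥ y := by
    rw [abs_le]; constructor <;> linarith
  rcases hq0.lt_or_eq with hpos | hzero
  · refine ⟨0, y ᵥ* (Q + Qᵀ), by simpa using hx, ?_, ?_⟩
    · have : (y ᵥ* (Q + Qᵀ)) ⬝ᵥ y = 2 * (y ⬝ᵥ Q *ᵥ y) := by
        rw [Matrix.vecMul_add, add_dotProduct, ← Matrix.dotProduct_mulVec, Matrix.vecMul_transpose,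
          dotProduct_comm (Q *ᵥ y)]
        ring
      rw [this]; omega
    · simp only [zero_smul, add_zero]
      refine Represented.of_abs_le (fun j => ?_) (hs.trans ?_)
      · have := abs_dotProduct_le y (fun i => (Q + Qᵀ) i j) Y (a + a) hyY fun i => by
          simp only [Matrix.add_apply, Matrix.transpose_apply]
          exact (abs_add_le _ _).trans (add_le_add (hQ i j) (hQ j i))
        refine this.trans ?_
        linarith
      · have h1 : ∀ i, |(Q *ᵥ y) i| ≤ n * (a * Y) := fun i => abs_dotProduct_le (Q i) y a Y (hQ i) hyY
        have := abs_dotProduct_le y _ Y _ hyY h1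
        refine (le_abs_self _).trans (this.trans ?_)
        linarith
  · rw [← hzero, abs_nonpos_iff] at hs
    -- Linear and quadratic term both vanish, so every feasible point of the line is again a
    -- minimizer.
    have hmin : ∀ l : ℤ, A *ᵥ (x + l • y) ≤ b → IsMinimizer Q A b (x + l • y) := by
      intro l hl
      refine ⟨hl, fun z hz => ?_⟩
      rw [quadratic_add_smul, hs, ← hzero]
      simpa using hx.2 z hz
    by_cases hA0 : ∃ i, (A *ᵥ y) i ≠ 0
    · obtain ⟨i, hi⟩ := hA0
      rcases lt_or_gt_of_ne hi with hneg | hpos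
      · have h1 : 0 < (A *ᵥ (-y)) i := by rw [Matrix.mulVec_neg]; simpa using hneg
        obtain ⟨l, h2, k, h3, h4⟩ := exists_boundary (-y) hx.1 h1
        simp only [Matrix.mulVec_neg, Pi.neg_apply, abs_neg, smul_neg, ← neg_smul] at h2 h3 h4
        refine ⟨-l, A k, hmin _ h2, fun h => ?_, represented_of_near_boundary hA hT hT' h2 h4 hK1
          haK (hAy k)⟩
        have : (A *ᵥ y) k = 0 := h
        omega
      · obtain ⟨l, h2, k, h3, h4⟩ := exists_boundary y hx.1 hpos
        exact ⟨l, A k, hmin _ h2, h3.ne', represented_of_near_boundary hA hT hT' h2 h4 hK1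
          haK (hAy k)⟩
    · push Not at hA0
      -- No constraint sees `y`, so the whole line is feasible; this multiple replaces `x k` by its
      -- remainder modulo `y k`, and the `k`-th coordinate becomes the new form.
      refine ⟨-(x k / y k), Pi.single k 1, hmin _ fun i => ?_, ?_, ?_⟩
      · rw [mulVec_add_smul_apply, hA0 i]
        simpa using hx.1 i
      · simpa using hk
      · refine Represented.of_abs_le (fun j => ?_) ?_
        · by_cases h : j = k
          · subst h; simpa using hK1
          · simp [Pi.single_eq_of_ne h]; omega
        · have h1 : (x + (-(x k / y k)) • y) k = x k % y k := by
            rw [Int.emod_def]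
            simp only [Pi.add_apply, Pi.smul_apply, smul_eq_mul]
            ring
          rw [single_one_dotProduct, h1, abs_of_nonneg (Int.emod_nonneg _ hk)]
          have := Int.emod_lt_abs (x k) hk
          have := hyY k
          linarith

end Step

/-- The bounds on the coefficients that arise from an iterated use of Siegel's lemma. -/
def coeffBound (n a : ℕ) : ℕ → ℕ
  | 0 => 1
  | t + 1 => (4 * (n + 1) * (a + 1) * coeffBound n a t) ^ (2 * n + 2)

theorem one_le_coeffBound (n a t : ℕ) : 1 ≤ coeffBound n a t := by
  induction t with
  | zero => simp [coeffBound]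
  | succ t ih => exact Nat.one_le_pow _ _ (by positivity)

theorem coeffBound_le_succ (n a t : ℕ) : coeffBound n a t ≤ coeffBound n a (t + 1) := by
  have h := one_le_coeffBound n a t
  calc coeffBound n a t ≤ 4 * (n + 1) * (a + 1) * coeffBound n a t :=
        Nat.le_mul_of_pos_left _ (by positivity)
    _ ≤ _ := Nat.le_self_pow (by omega) _

theorem coeffBound_mono (n a : ℕ) : Monotone (coeffBound n a) :=
  monotone_nat_of_le_succ (coeffBound_le_succ n a)

/-- Of the exponent `2n + 2`, two factors absorb `4 N² (a+1)` and the other `2n` absorb the squared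
Siegel bound. Taking `N = n + 1` covers the kernel vectors of length `n` as well as those of length
`n + 1`. -/
theorem le_coeffBound_succ {n : ℕ} (a t : ℕ) {K N : ℤ} (hK : coeffBound n a t = K) (hN : N = n + 1) :
    4 * N ^ 2 * (a + 1) * ((N * K) ^ n) ^ 2 ≤ coeffBound n a (t + 1) := by
  subst hK hN
  have h : 1 ≤ (coeffBound n a t : ℤ) := by exact_mod_cast one_le_coeffBound n a t
  have h0 : (0 : ℤ) ≤ a := by positivity
  simp only [coeffBound]
  push_cast
  generalize (coeffBound n a t : ℤ) = K at *
  have h1 : (n + 1 : ℤ) * K ≤ 4 * (n + 1) * (a + 1) * K := by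
    have : 0 ≤ (n + 1 : ℤ) * K := by positivity
    nlinarith [mul_nonneg this h0]
  have h2 : 4 * (n + 1 : ℤ) ^ 2 * (a + 1) ≤ (4 * (n + 1) * (a + 1) * K) ^ 2 := by
    have e : (4 * (n + 1) * (a + 1) * K : ℤ) ^ 2 =
      (4 * (n + 1) ^ 2 * (a + 1)) * (4 * (a + 1) * K ^ 2) := by ring
    rw [e]
    refine le_mul_of_one_le_right (by positivity) ?_
    nlinarith [one_le_pow₀ h (n := 2)]
  calc 4 * (n + 1 : ℤ) ^ 2 * (a + 1) * (((n + 1) * K) ^ n) ^ 2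
      ≤ (4 * (n + 1) * (a + 1) * K) ^ 2 * ((4 * (n + 1) * (a + 1) * K) ^ n) ^ 2 := by
        gcongr
    _ = _ := by ring

/-! ### Independent forms and the shape of a minimizer -/

section Main

variable {Q : Matrix (Fin n) (Fin n) ℤ} {A : Matrix (Fin m) (Fin n) ℤ} {b : Fin m → ℤ}
  {T : Fin R → ℤ} {code : Fin m → Fin R} {a : ℕ}

theorem IsMinimizer.exists_independent (hQ : ∀ i j, |Q i j| ≤ a) (hA : ∀ i j, |A i j| ≤ a)
    (hT : ∀ i, T (code i) ≤ b i)
    (hT' : ∀ x, A *ᵥ x ≤ b → ∀ i, (A *ᵥ x) i ≤ T (code i)) {x₀ : Fin n → ℤ}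
    (hx₀ : IsMinimizer Q A b x₀) (t : ℕ) (ht : t ≤ n) :
    ∃ (x : Fin n → ℤ) (ρ : Fin t → Fin n → ℤ), IsMinimizer Q A b x ∧
      (∀ z : Fin t → ℤ, ∑ i, z i • ρ i = 0 → z = 0) ∧
      ∀ i, Represented T x (coeffBound n a t) (ρ i) := by
  induction t with
  | zero => exact ⟨x₀, fun i => i.elim0, hx₀, fun z _ => funext fun i => i.elim0, fun i => i.elim0⟩
  | succ t ih =>
    obtain ⟨x, ρ, hx, hind, hρ⟩ := ih (by omega)
    have hK1 : (1 : ℤ) ≤ coeffBound n a t := by exact_mod_cast one_le_coeffBound n a t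
    obtain ⟨y, hy0, hy, hyb⟩ := exists_int_kernel_vec (by omega : t < n) ρ _ hK1 fun i => (hρ i).1
    have hn : (1 : ℤ) ≤ n := by exact_mod_cast (by omega : 1 ≤ n)
    obtain ⟨l, σ, hx', hσ, hσr⟩ := hx.exists_represented (K := coeffBound n a (t + 1)) hQ hA hT hT'
      hy0 (fun j => (hyb j).trans (pow_le_pow_right₀ (by nlinarith) (by omega : t ≤ n)))
      (by positivity) (one_le_pow₀ (by nlinarith))
      (le_trans (by gcongr <;> omega) (le_coeffBound_succ a t rfl rfl))
    refine ⟨x + l • y, Fin.snoc ρ σ, hx', fun z hz => ?_, fun i => ?_⟩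
    · rw [Fin.sum_univ_castSucc] at hz
      simp only [Fin.snoc_castSucc, Fin.snoc_last] at hz
      -- Evaluating the relation at `y` kills the old forms and isolates the coefficient of the new
      -- one.
      have h1 := congrArg (· ⬝ᵥ y) hz
      simp only [add_dotProduct, sum_dotProduct, smul_dotProduct, hy, mul_zero,
        Finset.sum_const_zero, zero_add, zero_dotProduct, smul_eq_mul, mul_eq_zero, hσ,
        or_false] at h1
      rw [h1, zero_smul, add_zero] at hz
      have h2 := hind (fun i => z i.castSucc) hz
      funext i
      refine Fin.lastCases h1 (fun j => congrFun h2 j) i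
    · refine Fin.lastCases ?_ (fun j => ?_) i
      · simpa using hσr
      · rw [Fin.snoc_castSucc]
        obtain ⟨h1, w, c, h2, h3, h4⟩ := hρ j
        refine Represented.mono ⟨h1, w, c, h2, h3, ?_⟩
          (by exact_mod_cast coeffBound_le_succ n a t)
        -- The old forms vanish at `y`, so their values do not change under the move.
        rw [dotProduct_add, dotProduct_smul, hy, smul_zero, add_zero, h4]

/-- The `n + 1` vectors `ρ i` and `-e_k` in dimension `n` have a short integral relation, which
expresses a multiple `D * x k` through the known values of the forms. It plays the role of Cramer's
rule. -/
theorem exists_coordinate_representation {x : Fin n → ℤ} {ρ : Fin n → Fin n → ℤ}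
    (hind : ∀ z : Fin n → ℤ, ∑ i, z i • ρ i = 0 → z = 0)
    (hρ : ∀ i, Represented T x (coeffBound n a n) (ρ i)) (k : Fin n) :
    ∃ (w : Fin R → ℤ) (c D : ℤ), (∀ r, |w r| ≤ coeffBound n a (n + 1)) ∧
      |c| ≤ coeffBound n a (n + 1) ∧ |D| ≤ coeffBound n a (n + 1) ∧ D ≠ 0 ∧
      D * x k = ∑ r, w r * T r + c := by
  have hK1 : (1 : ℤ) ≤ coeffBound n a n := by exact_mod_cast one_le_coeffBound n a n
  choose w c hw hc hρx using fun i => (hρ i).2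
  obtain ⟨z, hz0, hz, hzb⟩ := exists_int_kernel_vec (Nat.lt_succ_self n)
    (fun j => Fin.snoc (fun i => ρ i j) ((Pi.single k (-1) : Fin n → ℤ) j)) _ hK1 (fun j => Fin.lastCases
      (by
        rw [Fin.snoc_last]
        by_cases h : j = k
        · subst h; simpa using hK1
        · simp [Pi.single_eq_of_ne h])
      (fun i => by rw [Fin.snoc_castSucc]; exact (hρ i).1 j))
  have hz' : ∑ i : Fin n, z i.castSucc • ρ i = z (Fin.last n) • Pi.single k 1 := by
    funext j
    have h1 := hz j
    rw [dotProduct, Fin.sum_univ_castSucc] at h1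
    simp only [Fin.snoc_castSucc, Fin.snoc_last] at h1
    rw [Finset.sum_apply]
    simp only [Pi.smul_apply, smul_eq_mul]
    have h2 : (Pi.single k (-1) : Fin n → ℤ) j = - (Pi.single k 1 : Fin n → ℤ) j := by
      simp [Pi.single_apply, apply_ite Neg.neg]
    rw [h2] at h1
    simp only [mul_comm (z _)] at *
    linarith
  have hn : (1 : ℤ) ≤ n := by exact_mod_cast Fin.pos k
  have hbig := le_coeffBound_succ (n := n) a n rfl rfl
  have hZ1 : (1 : ℤ) ≤ ((n + 1) * (coeffBound n a n : ℤ)) ^ n := one_le_pow₀ (by nlinarith)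
  have hKZ : ((n + 1) * (coeffBound n a n : ℤ)) ≤ ((n + 1) * (coeffBound n a n : ℤ)) ^ n :=
    le_self_pow₀ (by nlinarith) (by have := Fin.pos k; omega)
  push_cast at hzb
  generalize hZ : ((n + 1) * (coeffBound n a n : ℤ)) ^ n = Z at *
  generalize hM : (coeffBound n a (n + 1) : ℤ) = M at *
  generalize hK : (coeffBound n a n : ℤ) = K at *
  have ha : (0 : ℤ) ≤ a := by positivity
  have hM1 : n * (Z * K) ≤ M := by
    have h1 : (n * K) * Z ≤ Z ^ 2 := by nlinarith
    have h2 : Z ^ 2 ≤ 4 * (n + 1 : ℤ) ^ 2 * (a + 1) * Z ^ 2 :=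
      le_mul_of_one_le_left (by positivity) (by nlinarith)
    linarith
  have hM2 : Z ≤ M := by
    refine le_trans ?_ hM1
    have : 1 ≤ n * K := by nlinarith
    nlinarith
  refine ⟨fun r => ∑ i, z i.castSucc * w i r, ∑ i, z i.castSucc * c i, z (Fin.last n), fun r => ?_,
    ?_, (hzb _).trans hM2, fun h0 => ?_, ?_⟩
  · exact (abs_dotProduct_le _ (fun i => w i r) _ _ (fun i => hzb i.castSucc) fun i => hw i r).trans hM1
  · exact (abs_dotProduct_le _ c _ _ (fun i => hzb i.castSucc) hc).trans hM1
  -- If `D` were zero, the relation would involve only the independent forms and would be trivial.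
  · rw [h0, zero_smul] at hz'
    have h1 := hind _ hz'
    exact hz0 (funext fun i => Fin.lastCases h0 (fun j => congrFun h1 j) i)
  · have h1 := congrArg (· ⬝ᵥ x) hz'
    simp only [sum_dotProduct, smul_dotProduct, single_one_dotProduct, smul_eq_mul] at h1
    rw [← h1]
    simp only [hρx, mul_add, Finset.sum_add_distrib, Finset.sum_mul, Finset.mul_sum]
    rw [Finset.sum_comm]
    simp only [mul_assoc]

theorem IsMinimizer.exists_candidate (hQ : ∀ i j, |Q i j| ≤ a) (hA : ∀ i j, |A i j| ≤ a)
    (hT : ∀ i, T (code i) ≤ b i)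
    (hT' : ∀ x, A *ᵥ x ≤ b → ∀ i, (A *ᵥ x) i ≤ T (code i)) {x₀ : Fin n → ℤ}
    (hx₀ : IsMinimizer Q A b x₀) :
    ∃ x, IsMinimizer Q A b x ∧ ∀ k, ∃ (w : Fin R → ℤ) (c D : ℤ),
      (∀ r, |w r| ≤ coeffBound n a (n + 1)) ∧ |c| ≤ coeffBound n a (n + 1) ∧
      |D| ≤ coeffBound n a (n + 1) ∧ D ≠ 0 ∧ D * x k = ∑ r, w r * T r + c := by
  obtain ⟨x, ρ, hx, hind, hρ⟩ := hx₀.exists_independent hQ hA hT hT' n le_rfl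
  exact ⟨x, hx, exists_coordinate_representation hind hρ⟩

end Main

end Candidates

/-! ## Terms that are evaluated by the machine -/

namespace RAM

theorem bitLen_le_iff {z : ℤ} {u : ℕ} : bitLen z ≤ u + 1 ↔ |z| < 2 ^ u := by
  rw [bitLen, Nat.add_le_add_iff_right, Nat.size_le, Int.abs_eq_natAbs]
  exact_mod_cast Iff.rfl

theorem bitLen_mono {y z : ℤ} (h : |y| ≤ |z|) : bitLen y ≤ bitLen z := by
  rw [bitLen, bitLen, Nat.add_le_add_iff_right]
  rw [Int.abs_eq_natAbs, Int.abs_eq_natAbs] at h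
  exact Nat.size_le_size (by exact_mod_cast h)

theorem Op.cost_le {U : ℕ} (hU : 2 ≤ U) (o : Op) {y z : ℤ} (hy : bitLen y ≤ U)
    (hz : bitLen z ≤ U) : o.cost y z ≤ U ^ 2 := by
  cases o <;> simp only [Op.cost] <;> nlinarith

/-- A family of programs, indexed by the number of registers in use, that compute a number;
`deg` is the exponent of the time bound. -/
structure Term where
  /-- a program that computes the number into register `d` and keeps the registers below `d` -/
  code : ℕ → Prog
  /-- the exponent of the time bound -/
  deg : ℕ

namespace Term

/-- A constant. -/
def lit (c : ℤ) : Term := ⟨fun d => .const d c, 1⟩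

/-- The contents of a register. -/
def var (l : ℕ) : Term := ⟨fun d => .seq (.const d 0) (.arith .add d d l), 2⟩

/-- An arithmetic operation. -/
def bin (o : Op) (a b : Term) : Term :=
  ⟨fun d => .seq (a.code d) (.seq (b.code (d + 1)) (.arith o d d (d + 1))), a.deg + b.deg + 3⟩

/-- The contents of a memory cell. -/
def load (a : Term) : Term := ⟨fun d => .seq (a.code d) (.load d d), a.deg + 3⟩

/-- `a` if `c` is positive, otherwise `b`. -/
def ifpos (c a b : Term) : Term :=
  ⟨fun d => .seq (c.code d) (.cond d (a.code d) (b.code d)), c.deg + a.deg + b.deg + 3⟩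

/-- The body of the loop of `fold`. -/
def foldBody (f : Term → Term → Term) (d : ℕ) : Prog :=
  .seq ((f (var (d + 1)) (var (d + 2))).code (d + 3)) <|
    .seq (.const (d + 2) 0) <| .seq (.arith .add (d + 2) (d + 2) (d + 3)) <|
    .seq (.const (d + 3) 1) <| .seq (.arith .add (d + 1) (d + 1) (d + 3)) <|
    .arith .sub (d + 3) d (d + 1)

/-- Iterate `f i` for `i = 0, …, N - 1`, starting from `z`. -/
def fold (N z : Term) (f : Term → Term → Term) : Term :=
  ⟨fun d => .seq (N.code d) <| .seq (z.code (d + 2)) <| .seq (.const (d + 1) 0) <|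
    .seq (.arith .sub (d + 3) d (d + 1)) <| .seq (.loop (d + 3) (foldBody f d)) <|
    .seq (.const d 0) (.arith .add d d (d + 2)), N.deg + z.deg + (f (var 0) (var 0)).deg + 6⟩

instance : Add Term := ⟨bin .add⟩
instance : Sub Term := ⟨bin .sub⟩
instance : Mul Term := ⟨bin .mul⟩
instance : Div Term := ⟨bin .div⟩

end Term

open Term

/-- In every state whose memory satisfies `H` and whose registers below `d` are as in `ρ`, the term
`t` evaluates to `v` in time `U ^ t.deg`. -/
def Den (U : ℕ) (H : (ℕ → ℤ) → Prop) (d : ℕ) (ρ : ℕ → ℤ) (t : Term) (v : ℤ) : Prop :=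
  bitLen v ≤ U ∧ ∀ (d' : ℕ) (s : State), d ≤ d' → (∀ l < d, s.reg l = ρ l) → H s.mem →
    ∃ s' τ, Exec (t.code d') s s' τ ∧ τ ≤ U ^ t.deg ∧ s'.reg d' = v ∧ s'.mem = s.mem ∧
      ∀ l < d', s'.reg l = s.reg l

variable {U : ℕ} {H : (ℕ → ℤ) → Prop} {d : ℕ} {ρ : ℕ → ℤ} {a b c : Term} {u v w : ℤ}

theorem Den.mono (h : Den U H d ρ a v) {d' : ℕ} {ρ' : ℕ → ℤ} (hd : d ≤ d')
    (hρ : ∀ l < d, ρ' l = ρ l) : Den U H d' ρ' a v :=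
  ⟨h.1, fun e s he hs hm =>
    h.2 e s (hd.trans he) (fun l hl => (hs l (hl.trans_le hd)).trans (hρ l hl)) hm⟩

theorem Den.lit (h : bitLen v ≤ U) : Den U H d ρ (lit v) v :=
  ⟨h, fun e s _ _ _ => ⟨_, _, Exec.const s e v, by simpa [Term.lit] using h,
    by simp [State.setReg], rfl, fun l hl => by simp [State.setReg, Function.update, hl.ne]⟩⟩

theorem bitLen_zero : bitLen 0 = 1 := by simp [bitLen]

theorem bitLen_one : bitLen 1 = 2 := by simp [bitLen]

theorem Den.var (hU : 2 ≤ U) {l : ℕ} (hl : l < d) (h : bitLen (ρ l) ≤ U) :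
    Den U H d ρ (var l) (ρ l) := by
  refine ⟨h, fun e s he hs _ => ⟨_, _, Exec.seq (Exec.const s e 0) (Exec.arith _ .add e e l), ?_,
    ?_, rfl, fun k hk => ?_⟩⟩
  -- Register `e` is cleared before `l` is added to it; this is harmless because `l` lies below `e`.
  · have : l ≠ e := by omega
    simp only [Term.var, Op.cost, State.setReg, Function.update_self, Function.update_of_ne this,
      hs l hl, bitLen_zero]
    nlinarith
  · have : l ≠ e := by omega
    simp [State.setReg, Op.eval, Function.update_of_ne this, hs l hl]
  · simp [State.setReg, Function.update_of_ne hk.ne]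

/-- The second operand is evaluated one register higher, so the first one survives. The operation
costs at most `U ^ 2`, and the spare exponents in `deg` absorb the sum of the three costs. -/
theorem Den.bin (hU : 8 ≤ U) (ha : Den U H d ρ a u) (hb : Den U H d ρ b v) {o : Op}
    (h : bitLen (o.eval u v) ≤ U) : Den U H d ρ (bin o a b) (o.eval u v) := by
  refine ⟨h, fun e s he hs hm => ?_⟩
  obtain ⟨s1, τ1, x1, t1, r1, m1, k1⟩ := ha.2 e s he hs hm
  obtain ⟨s2, τ2, x2, t2, r2, m2, k2⟩ := hb.2 (e + 1) s1 (by omega)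
    (fun l hl => (k1 l (by omega)).trans (hs l hl)) (m1 ▸ hm)
  have h1 : s2.reg e = u := (k2 e (by omega)).trans r1
  refine ⟨_, _, x1.seq (x2.seq (Exec.arith s2 o e e (e + 1))), ?_, ?_, m2.trans m1, fun l hl => ?_⟩
  · rw [h1, r2]
    have h2 := o.cost_le (by omega) ha.1 hb.1
    have h3 : U ^ a.deg ≤ U ^ (a.deg + b.deg + 2) := Nat.pow_le_pow_right (by omega) (by omega)
    have h4 : U ^ b.deg ≤ U ^ (a.deg + b.deg + 2) := Nat.pow_le_pow_right (by omega) (by omega)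
    have h5 : U ^ 2 ≤ U ^ (a.deg + b.deg + 2) := Nat.pow_le_pow_right (by omega) (by omega)
    have h6 : (Term.bin o a b).deg = a.deg + b.deg + 2 + 1 := rfl
    rw [h6, pow_succ]
    nlinarith
  · simp [State.setReg, h1, r2]
  · simp only [State.setReg, Function.update_of_ne hl.ne]
    exact (k2 l (by omega)).trans (k1 l hl)

theorem Den.add (hU : 8 ≤ U) (ha : Den U H d ρ a u) (hb : Den U H d ρ b v)
    (h : bitLen (u + v) ≤ U) : Den U H d ρ (a + b) (u + v) :=
  Den.bin hU ha hb (o := .add) h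

theorem Den.sub (hU : 8 ≤ U) (ha : Den U H d ρ a u) (hb : Den U H d ρ b v)
    (h : bitLen (u - v) ≤ U) : Den U H d ρ (a - b) (u - v) :=
  Den.bin hU ha hb (o := .sub) h

theorem Den.mul (hU : 8 ≤ U) (ha : Den U H d ρ a u) (hb : Den U H d ρ b v)
    (h : bitLen (u * v) ≤ U) : Den U H d ρ (a * b) (u * v) :=
  Den.bin hU ha hb (o := .mul) h

theorem Den.div (hU : 8 ≤ U) (ha : Den U H d ρ a u) (hb : Den U H d ρ b v) :
    Den U H d ρ (a / b) (u / v) :=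
  Den.bin hU ha hb (o := .div) ((bitLen_mono (Int.abs_ediv_le_abs u v)).trans ha.1)

theorem Den.load (hU : 8 ≤ U) {k : ℕ} (ha : Den U H d ρ a k) (h : bitLen v ≤ U)
    (hk : ∀ M, H M → M k = v) : Den U H d ρ (load a) v := by
  refine ⟨h, fun e s he hs hm => ?_⟩
  obtain ⟨s1, τ1, x1, t1, r1, m1, k1⟩ := ha.2 e s he hs hm
  have h1 : s1.mem k = v := by rw [m1]; exact hk _ hm
  refine ⟨_, _, x1.seq (Exec.load s1 e e k r1), ?_, ?_, m1, fun l hl => ?_⟩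
  · rw [h1]
    have h2 := ha.1
    have h3 : U ^ a.deg ≤ U ^ (a.deg + 2) := Nat.pow_le_pow_right (by omega) (by omega)
    have h5 : U ^ 2 ≤ U ^ (a.deg + 2) := Nat.pow_le_pow_right (by omega) (by omega)
    have h6 : (Term.load a).deg = a.deg + 2 + 1 := rfl
    rw [h6, pow_succ]
    nlinarith
  · simp [State.setReg, h1]
  · simpa [State.setReg, Function.update_of_ne hl.ne] using k1 l hl

/-- Only the branch that is taken must evaluate correctly, but `deg` counts both, so that it does
not depend on the input. -/
theorem Den.ifpos (hU : 8 ≤ U) (hc : Den U H d ρ c w)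
    (ha : 0 < w → Den U H d ρ a u) (hb : ¬ 0 < w → Den U H d ρ b v) :
    Den U H d ρ (ifpos c a b) (if 0 < w then u else v) := by
  have h3 : U ^ c.deg ≤ U ^ (c.deg + a.deg + b.deg + 2) :=
    Nat.pow_le_pow_right (by omega) (by omega)
  have h4 : U ^ a.deg ≤ U ^ (c.deg + a.deg + b.deg + 2) :=
    Nat.pow_le_pow_right (by omega) (by omega)
  have h5 : U ^ b.deg ≤ U ^ (c.deg + a.deg + b.deg + 2) :=
    Nat.pow_le_pow_right (by omega) (by omega)
  have h6 : U ^ 1 ≤ U ^ (c.deg + a.deg + b.deg + 2) :=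
    Nat.pow_le_pow_right (by omega) (by omega)
  have h7 : U ^ (Term.ifpos c a b).deg = U ^ (c.deg + a.deg + b.deg + 2) * U := pow_succ _ _
  have hw := hc.1
  split_ifs with h
  · refine ⟨(ha h).1, fun e s he hs hm => ?_⟩
    obtain ⟨s1, τ1, x1, t1, r1, m1, k1⟩ := hc.2 e s he hs hm
    obtain ⟨s2, τ2, x2, t2, r2, m2, k2⟩ := (ha h).2 e s1 he
      (fun l hl => (k1 l (by omega)).trans (hs l hl)) (m1 ▸ hm)
    refine ⟨_, _, x1.seq (Exec.cond_pos (by rwa [r1]) x2), ?_, r2, m2.trans m1,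
      fun l hl => (k2 l hl).trans (k1 l hl)⟩
    rw [r1, h7]
    nlinarith
  · refine ⟨(hb h).1, fun e s he hs hm => ?_⟩
    obtain ⟨s1, τ1, x1, t1, r1, m1, k1⟩ := hc.2 e s he hs hm
    obtain ⟨s2, τ2, x2, t2, r2, m2, k2⟩ := (hb h).2 e s1 he
      (fun l hl => (k1 l (by omega)).trans (hs l hl)) (m1 ▸ hm)
    refine ⟨_, _, x1.seq (Exec.cond_nonpos (by rw [r1]; omega) x2), ?_, r2, m2.trans m1,
      fun l hl => (k2 l hl).trans (k1 l hl)⟩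
    rw [r1, h7]
    nlinarith

/-- If `f` computes one step of the sequence `acc` in all states that extend a given one, the loop
of `fold` computes the last member of the sequence. -/
theorem Den.fold (hU : 8 ≤ U) {N z : Term} {f : Term → Term → Term} {k : ℕ} {acc : ℕ → ℤ}
    (hN : Den U H d ρ N k) (hk : k ≤ U) (hz : Den U H d ρ z (acc 0))
    (hf : ∀ i < k, ∀ d' ρ' x y, d ≤ d' → (∀ l < d, ρ' l = ρ l) → Den U H d' ρ' x i →
      Den U H d' ρ' y (acc i) → Den U H d' ρ' (f x y) (acc (i + 1)))
    (hdeg : ∀ i j, (f (.var i) (.var j)).deg = (f (.var 0) (.var 0)).deg := by intros; rfl) :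
    Den U H d ρ (fold N z f) (acc k) := by
  have hacc : ∀ i ≤ k, bitLen (acc i) ≤ U := by
    intro i hi
    induction i with
    | zero => exact hz.1
    | succ i ih =>
      have hiU : bitLen (i : ℤ) ≤ U := (bitLen_mono (by
        rw [abs_of_nonneg (by positivity), abs_of_nonneg (by positivity)]
        exact_mod_cast (by omega : i ≤ k))).trans hN.1
      -- An artificial state holding `i` and `acc i` lets `hf` be applied; the length bound on `acc
      -- (i + 1)` is part of its conclusion.
      set ρ' : ℕ → ℤ := fun l => if l = d then i else if l = d + 1 then acc i else ρ l with hρ'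
      have e0 : ρ' d = i := by simp [hρ']
      have e1 : ρ' (d + 1) = acc i := by simp [hρ']
      refine (hf i hi (d + 2) ρ' (.var d) (.var (d + 1)) (by omega) (fun l hl => ?_) ?_ ?_).1
      · rw [hρ']
        simp only
        rw [if_neg (by omega), if_neg (by omega)]
      · rw [← e0]
        exact Den.var (by omega) (by omega) (by rwa [e0])
      · rw [← e1]
        exact Den.var (by omega) (by omega) (by rw [e1]; exact ih (by omega))
  have hsmall : ∀ y : ℤ, 0 ≤ y → y ≤ k → bitLen y ≤ U := fun y h1 h2 =>
    (bitLen_mono (by rwa [abs_of_nonneg h1, abs_of_nonneg (by positivity)])).trans hN.1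
  refine ⟨hacc k le_rfl, fun e s he hs hm => ?_⟩
  set J := (f (.var 0) (.var 0)).deg
  -- Loop invariant: register `e` holds the number of rounds, `e + 1` the counter, `e + 2` the
  -- accumulator and `e + 3` the rounds left, which controls the loop.
  have hloop : ∀ r i, i + r = k → ∀ s1 : State, s1.reg e = k → s1.reg (e + 1) = i →
      s1.reg (e + 2) = acc i → s1.reg (e + 3) = k - i → s1.mem = s.mem →
      (∀ l < e, s1.reg l = s.reg l) →
      ∃ s2 τ, Exec (.loop (e + 3) (foldBody f e)) s1 s2 τ ∧ τ ≤ r * U ^ (J + 3) + U ∧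
        s2.reg (e + 2) = acc k ∧ s2.mem = s.mem ∧ ∀ l < e, s2.reg l = s.reg l := by
    intro r
    induction r with
    | zero =>
      intro i hi s1 h0 h1 h2 h3 hm1 hl1
      obtain rfl : i = k := by omega
      refine ⟨_, _, Exec.loop_nonpos (by omega), ?_, h2, hm1, hl1⟩
      rw [h3, sub_self, bitLen_zero]
      omega
    | succ r ih =>
      intro i hi s1 h0 h1 h2 h3 hm1 hl1
      have hi' : i < k := by omega
      have hx : Den U H (e + 3) s1.reg (.var (e + 1)) i := by
        rw [← h1]
        exact Den.var (by omega) (by omega) (by rw [h1]; exact hsmall _ (by omega) (by omega))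
      have hy : Den U H (e + 3) s1.reg (.var (e + 2)) (acc i) := by
        rw [← h2]
        exact Den.var (by omega) (by omega) (by rw [h2]; exact hacc i hi'.le)
      have hb := hf i hi' (e + 3) s1.reg _ _ (by omega)
        (fun l hl => (hl1 l (by omega)).trans (hs l hl)) hx hy
      obtain ⟨s2, τ2, x2, t2, r2, m2, k2⟩ := hb.2 (e + 3) s1 le_rfl (fun _ _ => rfl) (hm1 ▸ hm)
      have g0 := (k2 e (by omega)).trans h0
      have g1 := (k2 (e + 1) (by omega)).trans h1
      rw [hdeg] at t2
      have c1 := hacc (i + 1) hi'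
      have c2 := hsmall (i : ℤ) (by omega) (by omega)
      have c3 := hsmall ((i : ℤ) + 1) (by omega) (by omega)
      have c4 := hsmall (k - i : ℤ) (by omega) (by omega)
      have c5 := hN.1
      obtain ⟨s4, τ4, x4, t4, q0, q1, q2, q3, qm, ql⟩ : ∃ s4 τ4, Exec (foldBody f e) s1 s4 τ4 ∧
          τ4 ≤ U ^ J + 5 * U + 6 ∧ s4.reg e = k ∧ s4.reg (e + 1) = (i + 1 : ℕ) ∧
          s4.reg (e + 2) = acc (i + 1) ∧ s4.reg (e + 3) = k - (i + 1 : ℕ) ∧ s4.mem = s.mem ∧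
          ∀ l < e, s4.reg l = s.reg l := by
        refine ⟨_, _, x2.seq <| (Exec.const s2 (e + 2) 0).seq <|
          (Exec.arith _ .add (e + 2) (e + 2) (e + 3)).seq <| (Exec.const _ (e + 3) 1).seq <|
          (Exec.arith _ .add (e + 1) (e + 1) (e + 3)).seq <| Exec.arith _ .sub (e + 3) e (e + 1),
          ?_, ?_, ?_, ?_, ?_, m2.trans hm1, fun l hl => ?_⟩
        · simp [State.setReg, g0, g1, r2, Op.cost, Op.eval, bitLen_zero, bitLen_one,
            Function.update]
          omega
        · simp [State.setReg, g0]
        · simp [State.setReg, g1, Op.eval]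
        · simp [State.setReg, r2, Op.eval]
        · simp [State.setReg, g0, g1, Op.eval]
        · simp only [State.setReg]
          rw [Function.update_of_ne (by omega), Function.update_of_ne (by omega),
            Function.update_of_ne (by omega), Function.update_of_ne (by omega),
            Function.update_of_ne (by omega)]
          exact (k2 l (by omega)).trans (hl1 l hl)
      obtain ⟨s3, τ3, x3, t3, r3, m3, k3⟩ := ih (i + 1) (by omega) s4 q0 q1 q2 q3 qm ql
      refine ⟨s3, _, Exec.loop_pos (by rw [h3]; omega) x4 x3, ?_, r3, m3, k3⟩
      have p1 : U ^ J ≤ U ^ (J + 2) := Nat.pow_le_pow_right (by omega) (by omega)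
      have p2 : U ^ 2 ≤ U ^ (J + 2) := Nat.pow_le_pow_right (by omega) (by omega)
      have p3 : U ^ (J + 3) = U ^ (J + 2) * U := pow_succ _ _
      have p4 : (r + 1) * U ^ (J + 3) = r * U ^ (J + 3) + U ^ (J + 3) := by ring
      rw [h3]
      nlinarith
  obtain ⟨s1, τ1, x1, t1, r1, m1, k1⟩ := hN.2 e s he hs hm
  obtain ⟨s2, τ2, x2, t2, r2, m2, k2⟩ := hz.2 (e + 2) s1 (by omega)
    (fun l hl => (k1 l (by omega)).trans (hs l hl)) (m1 ▸ hm)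
  have g0 := (k2 e (by omega)).trans r1
  obtain ⟨s3, τ3, x3, t3, r3, m3, k3⟩ := hloop k 0 (by omega)
    (((s2.setReg (e + 1) 0).setReg (e + 3) (Op.sub.eval ((s2.setReg (e + 1) 0).reg e)
      ((s2.setReg (e + 1) 0).reg (e + 1)))))
    (by simp [State.setReg, g0]) (by simp [State.setReg])
    (by simp [State.setReg, r2]) (by simp [State.setReg, g0, Op.eval])
    (by simp only [State.setReg]; exact m2.trans m1)
    (fun l hl => by
      simp only [State.setReg]
      rw [Function.update_of_ne (by omega), Function.update_of_ne (by omega)]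
      exact (k2 l (by omega)).trans (k1 l hl))
  refine ⟨_, _, x1.seq <| x2.seq <| (Exec.const s2 (e + 1) 0).seq <|
    (Exec.arith _ .sub (e + 3) e (e + 1)).seq <| x3.seq <| (Exec.const _ e 0).seq <|
    Exec.arith _ .add e e (e + 2), ?_, ?_, m3, fun l hl => ?_⟩
  · have c5 := hN.1
    have c6 := hacc k le_rfl
    have p1 : U ^ N.deg ≤ U ^ (N.deg + z.deg + J + 5) := Nat.pow_le_pow_right (by omega) (by omega)
    have p2 : U ^ z.deg ≤ U ^ (N.deg + z.deg + J + 5) := Nat.pow_le_pow_right (by omega) (by omega)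
    have p3 : U ^ (J + 4) ≤ U ^ (N.deg + z.deg + J + 5) :=
      Nat.pow_le_pow_right (by omega) (by omega)
    have p4 : U ^ 2 ≤ U ^ (N.deg + z.deg + J + 5) := Nat.pow_le_pow_right (by omega) (by omega)
    -- Because the number of rounds is at most `U`, a loop costs just one more power of `U`.
    have p5 : k * U ^ (J + 3) ≤ U ^ (J + 4) := by
      rw [pow_succ _ (J + 3), mul_comm]
      exact Nat.mul_le_mul_left _ hk
    have p6 : (Term.fold N z f).deg = N.deg + z.deg + J + 5 + 1 := rfl
    rw [p6, pow_succ]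
    simp [State.setReg, g0, r3, Op.cost, bitLen_zero, Function.update]
    nlinarith
  · simp [State.setReg, r3, Op.eval]
  · simp only [State.setReg]
    rw [Function.update_of_ne (by omega), Function.update_of_ne (by omega)]
    exact k3 l hl

end RAM

/-! ## The numbers that the algorithm computes -/

namespace IQP

/-- The bound on the coefficients of the candidates. -/
def coeffMax (n a : ℕ) : ℕ := coeffBound n a (n + 1)

/-- The number of rows of length `n` with entries bounded by `a`. -/
def rowCount (n a : ℕ) : ℕ := (2 * a + 1) ^ n

/-- The number of values of one coefficient. -/
def digitBase (n a : ℕ) : ℕ := 2 * coeffMax n a + 1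

/-- The number of coefficients that determine a candidate. -/
def digitCount (n a : ℕ) : ℕ := n * (rowCount n a + 2)

/-- The number of candidates. -/
def candCount (n a : ℕ) : ℕ := digitBase n a ^ digitCount n a

/-- A bound on all numbers that do not depend on the right-hand side. -/
def smallBound (n a : ℕ) : ℕ :=
  10 + n + n * n + a + n * a + 2 * (n * (n * a)) + rowCount n a + rowCount n a * rowCount n a +
    rowCount n a * coeffMax n a + coeffMax n a + digitBase n a + digitCount n a + candCount n a

variable (I : IQP)

/-- The square of the largest absolute value of a coefficient. -/
def a : ℕ := I.alpha ^ 2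

/-- The bound on all numbers related to the right-hand side. -/
def rhsBound : ℕ := I.size * 4 ^ I.size

/-- The bound on the number of bits and the base of the time bounds. -/
def timeBase : ℕ := 20 * smallBound I.n I.a * I.size

/-- The `k`-th number of the input. -/
def entry (k : ℕ) : ℤ := I.encode.getD k 0

/-- The number of memory cells of the input. -/
def len : ℕ := 2 + I.n * I.n + I.m * I.n + I.m

/-- The memory contains the instance. -/
def Holds (M : ℕ → ℤ) : Prop := ∀ k < I.len, M k = I.entry k

/-- The entries of `Q`. -/
def qv (i j : ℕ) : ℤ := I.entry (2 + (i * I.n + j))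

/-- The entries of `A`. -/
def av (i j : ℕ) : ℤ := I.entry (2 + I.n * I.n + (i * I.n + j))

/-- The entries of `b`. -/
def bv (i : ℕ) : ℤ := I.entry (2 + I.n * I.n + I.m * I.n + i)

/-! ### Layout of the input and first size bounds -/

theorem encode_eq : I.encode = (I.n : ℤ) :: (I.m : ℤ) ::
    ((List.ofFn fun k : Fin (I.n * I.n) => I.Q k.divNat k.modNat) ++
    ((List.ofFn fun k : Fin (I.m * I.n) => I.A k.divNat k.modNat) ++ List.ofFn I.b)) := by
  have h : ∀ (p q : ℕ) (B : Matrix (Fin p) (Fin q) ℤ),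
      (List.ofFn fun i => List.ofFn (B i)).flatten =
        List.ofFn fun k : Fin (p * q) => B k.divNat k.modNat := by
    intro p q B
    rw [List.ofFn_mul]
    congr 1
    refine congrArg _ (funext fun i => congrArg _ (funext fun j => ?_))
    have hq : 0 < q := Fin.pos j
    congr 1
    · apply Fin.ext
      simp [Fin.divNat, Nat.add_div_of_dvd_right, Nat.div_eq_of_lt j.2, hq,
        Nat.mul_comm]
    · apply Fin.ext
      simp [Fin.modNat, Nat.mod_eq_of_lt j.2]
  rw [encode, h, h]
  simp

theorem length_encode : I.encode.length = I.len := by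
  rw [encode_eq]
  simp [len]
  omega

theorem entry_zero : I.entry 0 = I.n := by simp [entry, encode_eq]

theorem entry_one : I.entry 1 = I.m := by simp [entry, encode_eq]

theorem qv_eq (i j : Fin I.n) : I.qv i j = I.Q i j := by
  have hn : 0 < I.n := Fin.pos j
  have h : (i * I.n + j : ℕ) < I.n * I.n := by nlinarith [i.2, j.2]
  rw [qv, entry, encode_eq, Nat.add_comm 2]
  simp only [List.getD_cons_succ]
  rw [List.getD_append _ _ _ _ (by simpa using h), List.getD_eq_getElem _ _ (by simpa using h)]
  simp only [List.getElem_ofFn]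
  congr 1
  · apply Fin.ext
    simp [Fin.divNat, Nat.mul_comm _ I.n, Nat.mul_add_div hn, Nat.div_eq_of_lt j.2]
  · apply Fin.ext
    simp [Fin.modNat, Nat.mod_eq_of_lt j.2]

theorem av_eq (i : Fin I.m) (j : Fin I.n) : I.av i j = I.A i j := by
  have hn : 0 < I.n := Fin.pos j
  have h : (i * I.n + j : ℕ) < I.m * I.n := by nlinarith [i.2, j.2]
  rw [av, entry, encode_eq, Nat.add_assoc, Nat.add_comm 2]
  simp only [List.getD_cons_succ]
  rw [List.getD_append_right _ _ _ _ (by simp), List.length_ofFn, Nat.add_sub_cancel_left,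
    List.getD_append _ _ _ _ (by simpa using h), List.getD_eq_getElem _ _ (by simpa using h)]
  simp only [List.getElem_ofFn]
  congr 1
  · apply Fin.ext
    simp [Fin.divNat, Nat.mul_comm _ I.n, Nat.mul_add_div hn, Nat.div_eq_of_lt j.2]
  · apply Fin.ext
    simp [Fin.modNat, Nat.mod_eq_of_lt j.2]

theorem bv_eq (i : Fin I.m) : I.bv i = I.b i := by
  rw [bv, entry, encode_eq, Nat.add_assoc, Nat.add_assoc, Nat.add_comm 2]
  simp only [List.getD_cons_succ]
  rw [List.getD_append_right _ _ _ _ (by simp), List.length_ofFn, Nat.add_sub_cancel_left,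
    List.getD_append_right _ _ _ _ (by simp), List.length_ofFn, Nat.add_sub_cancel_left,
    List.getD_eq_getElem _ _ (by simp)]
  simp

theorem one_le_bitLen (z : ℤ) : 1 ≤ RAM.bitLen z := Nat.le_add_left _ _

theorem len_le_size : I.len ≤ I.size := by
  rw [← length_encode, size, ← List.length_map (f := RAM.bitLen)]
  refine List.length_le_sum_of_one_le _ fun i hi => ?_
  obtain ⟨z, -, rfl⟩ := List.mem_map.1 hi
  exact one_le_bitLen z

theorem m_le_size : I.m ≤ I.size := (by simp [len] : I.m ≤ I.len).trans I.len_le_size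

theorem two_le_size : 2 ≤ I.size := (by unfold len; omega : 2 ≤ I.len).trans I.len_le_size

theorem abs_entry_le (k : ℕ) : |I.entry k| ≤ 2 ^ I.size := by
  rw [entry]
  by_cases hk : k < I.encode.length
  · rw [List.getD_eq_getElem _ _ hk]
    have h : RAM.bitLen I.encode[k] ≤ I.size :=
      List.le_sum_of_mem (List.mem_map_of_mem (List.getElem_mem hk))
    exact (RAM.bitLen_le_iff.1 (h.trans (Nat.le_succ _))).le
  · rw [List.getD_eq_default _ _ (by omega)]
    simp

theorem natAbs_Q_le (i j : Fin I.n) : (I.Q i j).natAbs ≤ I.alpha :=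
  (Finset.le_sup (f := fun p : Fin I.n × Fin I.n => (I.Q p.1 p.2).natAbs)
    (Finset.mem_univ (i, j))).trans (le_max_left _ _)

theorem natAbs_A_le (i : Fin I.m) (j : Fin I.n) : (I.A i j).natAbs ≤ I.alpha :=
  (Finset.le_sup (f := fun p : Fin I.m × Fin I.n => (I.A p.1 p.2).natAbs)
    (Finset.mem_univ (i, j))).trans (le_max_right _ _)

theorem alpha_le_a : I.alpha ≤ I.a := Nat.le_self_pow (by omega) _

theorem abs_Q_le (i j : Fin I.n) : |I.Q i j| ≤ I.a := by
  rw [Int.abs_eq_natAbs]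
  exact_mod_cast (I.natAbs_Q_le i j).trans I.alpha_le_a

theorem abs_A_le (i : Fin I.m) (j : Fin I.n) : |I.A i j| ≤ I.a := by
  rw [Int.abs_eq_natAbs]
  exact_mod_cast (I.natAbs_A_le i j).trans I.alpha_le_a

/-- The maximum of the squares of the first `j` coefficients. -/
def sqMax (j : ℕ) : ℕ := (Finset.range j).sup fun i => (I.entry (2 + i)).natAbs ^ 2

theorem natAbs_coeff_le {i : ℕ} (hi : i < I.n * I.n + I.m * I.n) :
    (I.entry (2 + i)).natAbs ≤ I.alpha := by
  have hn : 0 < I.n := Nat.pos_of_ne_zero fun h => by simp [h] at hi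
  by_cases h : i < I.n * I.n
  · have h1 := I.qv_eq ⟨i / I.n, Nat.div_lt_of_lt_mul h⟩ ⟨i % I.n, Nat.mod_lt _ hn⟩
    rw [qv] at h1
    simp only [Nat.div_add_mod'] at h1
    rw [h1]
    exact I.natAbs_Q_le _ _
  · obtain ⟨k, rfl⟩ := Nat.exists_eq_add_of_le (not_lt.1 h)
    have h1 := I.av_eq ⟨k / I.n, Nat.div_lt_of_lt_mul (by rw [Nat.mul_comm]; omega)⟩
      ⟨k % I.n, Nat.mod_lt _ hn⟩
    rw [av] at h1
    simp only [Nat.div_add_mod'] at h1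
    rw [← Nat.add_assoc, h1]
    exact I.natAbs_A_le _ _

theorem sqMax_le {j : ℕ} (hj : j ≤ I.n * I.n + I.m * I.n) : I.sqMax j ≤ I.a := by
  refine Finset.sup_le fun i hi => Nat.pow_le_pow_left (I.natAbs_coeff_le ?_) 2
  have := Finset.mem_range.1 hi
  omega

/-- The cells from 2 on hold exactly the entries of `Q` and `A`. Maximizing squares avoids absolute
values, which the machine lacks; the result `α²` still bounds the coefficients. -/
theorem sqMax_eq : I.sqMax (I.n * I.n + I.m * I.n) = I.a := by
  refine le_antisymm (I.sqMax_le le_rfl) ?_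
  have h1 : ∀ k < I.n * I.n + I.m * I.n,
      (I.entry (2 + k)).natAbs ^ 2 ≤ I.sqMax (I.n * I.n + I.m * I.n) := fun k hk =>
    Finset.le_sup (f := fun i => (I.entry (2 + i)).natAbs ^ 2) (Finset.mem_range.2 hk)
  rw [a, ← Nat.le_sqrt', alpha]
  refine max_le (Finset.sup_le fun p _ => Nat.le_sqrt'.2 ?_)
    (Finset.sup_le fun p _ => Nat.le_sqrt'.2 ?_)
  · rw [← qv_eq]
    exact h1 _ (by nlinarith [p.1.2, p.2.2])
  · rw [← av_eq, av, Nat.add_assoc]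
    exact h1 _ (by nlinarith [p.1.2, p.2.2])

theorem sqMax_succ (j : ℕ) : (I.sqMax (j + 1) : ℤ) =
    if 0 < I.entry (2 + j) * I.entry (2 + j) - I.sqMax j then I.entry (2 + j) * I.entry (2 + j)
    else I.sqMax j := by
  have h : ((I.entry (2 + j)).natAbs ^ 2 : ℕ) = I.entry (2 + j) * I.entry (2 + j) := by
    rw [pow_two]
    exact Int.natAbs_mul_self
  rw [← h, sqMax, Finset.range_add_one, Finset.sup_insert, ← sqMax]
  split_ifs with h1
  · exact_mod_cast max_eq_left (by omega)
  · exact_mod_cast max_eq_right (by omega)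

/-! ### Size bounds -/

theorem ten_le_smallBound (n a : ℕ) : 10 ≤ smallBound n a := by unfold smallBound; omega

theorem one_le_rhsBound : 1 ≤ I.rhsBound :=
  Nat.mul_pos (by have := I.two_le_size; omega) (by positivity)

theorem size_le_rhsBound : I.size ≤ I.rhsBound := Nat.le_mul_of_pos_right _ (by positivity)

theorem smallBound_mul_size_le : smallBound I.n I.a * I.size ≤ I.timeBase := by
  unfold timeBase
  nlinarith [Nat.zero_le (smallBound I.n I.a * I.size)]

theorem smallBound_le_timeBase : smallBound I.n I.a ≤ I.timeBase :=
  (Nat.le_mul_of_pos_right _ (by have := I.two_le_size; omega)).trans I.smallBound_mul_size_le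

theorem size_le_timeBase : I.size ≤ I.timeBase :=
  (Nat.le_mul_of_pos_left _ (by have := ten_le_smallBound I.n I.a; omega)).trans
    I.smallBound_mul_size_le

theorem eight_le_timeBase : 8 ≤ I.timeBase :=
  (by have := ten_le_smallBound I.n I.a; omega : 8 ≤ smallBound I.n I.a).trans
    I.smallBound_le_timeBase

/-- The bound on the entries of the candidates. -/
def candBound : ℕ := smallBound I.n I.a * I.rhsBound

/-- With `S = smallBound` and `L = size`, the hypothesis bounds `|z|` by `S³ (L 4^L)² < 2^(3S +
6L)`, and `3S + 6L + 1 ≤ 20 S L`. Objective values are the largest numbers that occur, whence the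
square. -/
theorem bitLen_le_timeBase {z : ℤ} (hz : |z| ≤ (smallBound I.n I.a * I.candBound ^ 2 : ℕ)) :
    RAM.bitLen z ≤ I.timeBase := by
  have h10 := ten_le_smallBound I.n I.a
  have hL := I.two_le_size
  have h1 : 3 * smallBound I.n I.a + 6 * I.size + 1 ≤ I.timeBase := by
    unfold timeBase
    nlinarith [Nat.mul_le_mul h10 hL]
  refine le_trans ?_ h1
  rw [RAM.bitLen_le_iff]
  refine hz.trans_lt ?_
  unfold candBound rhsBound
  norm_cast
  have h2 : smallBound I.n I.a < 2 ^ smallBound I.n I.a := Nat.lt_two_pow_self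
  have h3 : I.size < 2 ^ I.size := Nat.lt_two_pow_self
  generalize smallBound I.n I.a = S at *
  generalize I.size = L at *
  calc S * (S * (L * 4 ^ L)) ^ 2 = S ^ 3 * (L * 4 ^ L) ^ 2 := by ring
    _ < (2 ^ S) ^ 3 * (2 ^ L * 4 ^ L) ^ 2 := by gcongr
    _ = 2 ^ (3 * S + 6 * L) := by
        rw [show (4 : ℕ) = 2 ^ 2 from rfl, ← pow_mul, ← pow_mul, ← pow_add, ← pow_mul, ← pow_add]
        congr 1
        ring

theorem candBound_le : I.candBound ≤ I.candBound ^ 2 := Nat.le_self_pow (by omega) _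

theorem rhsBound_le_candBound : I.rhsBound ≤ I.candBound :=
  Nat.le_mul_of_pos_left _ (by have := ten_le_smallBound I.n I.a; omega)

theorem smallBound_le_candBound : smallBound I.n I.a ≤ I.candBound :=
  Nat.le_mul_of_pos_right _ I.one_le_rhsBound

theorem bitLen_le_of_mul_candBound {z : ℤ} (hz : |z| ≤ (smallBound I.n I.a * I.candBound : ℕ)) :
    RAM.bitLen z ≤ I.timeBase :=
  I.bitLen_le_timeBase (hz.trans (by exact_mod_cast Nat.mul_le_mul_left _ I.candBound_le))

theorem bitLen_le_of_candBound {z : ℤ} (hz : |z| ≤ I.candBound) : RAM.bitLen z ≤ I.timeBase :=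
  I.bitLen_le_of_mul_candBound (hz.trans (by
    exact_mod_cast Nat.le_mul_of_pos_left _ (by have := ten_le_smallBound I.n I.a; omega)))

theorem bitLen_le_of_rhsBound {z : ℤ} (hz : |z| ≤ I.rhsBound) : RAM.bitLen z ≤ I.timeBase :=
  I.bitLen_le_of_candBound (hz.trans (by exact_mod_cast I.rhsBound_le_candBound))

theorem bitLen_le_of_smallBound {z : ℤ} (hz : |z| ≤ smallBound I.n I.a) :
    RAM.bitLen z ≤ I.timeBase :=
  I.bitLen_le_of_candBound (hz.trans (by exact_mod_cast I.smallBound_le_candBound))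

theorem bitLen_nat_le_of_smallBound {z : ℕ} (hz : z ≤ smallBound I.n I.a) :
    RAM.bitLen z ≤ I.timeBase :=
  I.bitLen_le_of_smallBound (by rw [Nat.abs_cast]; exact_mod_cast hz)

theorem bitLen_nat_le_of_len {z : ℕ} (hz : z ≤ I.len) : RAM.bitLen z ≤ I.timeBase :=
  I.bitLen_le_of_rhsBound (by
    rw [Nat.abs_cast]
    exact_mod_cast hz.trans (I.len_le_size.trans I.size_le_rhsBound))

/-! ### The candidates -/

/-- The number that encodes the `i`-th row of `A`. -/
def rowCode (i : ℕ) : ℤ := ∑ j ∈ Finset.range I.n, (I.av i j + I.a) * (2 * I.a + 1) ^ j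

/-- The sum of the squares of the right-hand side. -/
def rhsSq : ℤ := ∑ i ∈ Finset.range I.m, I.bv i * I.bv i

/-- The strongest bound that the first `i` constraints impose on the row with the code `r`. -/
def rhsMin (r : ℕ) : ℕ → ℤ
  | 0 => I.rhsSq
  | i + 1 => if 0 < (I.rowCode i - r) * (I.rowCode i - r) then rhsMin r i
      else if 0 < rhsMin r i - I.bv i then I.bv i else rhsMin r i

/-- The `i`-th coefficient of the candidate `c`. -/
def coeff (c i : ℕ) : ℤ :=
  (c / digitBase I.n I.a ^ i % digitBase I.n I.a : ℕ) - (coeffMax I.n I.a : ℕ)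

/-- The `k`-th coordinate of the candidate `c`. -/
def cand (c k : ℕ) : ℤ :=
  (∑ r ∈ Finset.range (rowCount I.n I.a), I.coeff c (k * (rowCount I.n I.a + 2) + r) * I.rhsMin r I.m +
    I.coeff c (k * (rowCount I.n I.a + 2) + rowCount I.n I.a)) /
    I.coeff c (k * (rowCount I.n I.a + 2) + (rowCount I.n I.a + 1))

/-- The value of the `i`-th constraint at the candidate `c`. -/
def lhs (c i : ℕ) : ℤ := ∑ j ∈ Finset.range I.n, I.av i j * I.cand c j

/-- The number of constraints that the candidate `c` violates. -/
def violated (c : ℕ) : ℤ := ∑ i ∈ Finset.range I.m, if 0 < I.lhs c i - I.bv i then 1 else 0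

/-- The value of the candidate `c`. -/
def value (c : ℕ) : ℤ :=
  ∑ i ∈ Finset.range I.n, ∑ j ∈ Finset.range I.n, I.cand c i * (I.qv i j * I.cand c j)

/-- The best one of the first `j` candidates. -/
def best : ℕ → ℕ
  | 0 => 0
  | c + 1 => if 0 < I.violated c then best c else if 0 < I.violated (best c) then c
      else if 0 < I.value (best c) - I.value c then c else best c

/-! ### Magnitudes of the intermediate numbers -/

theorem bv_sq_le (i : ℕ) : I.bv i * I.bv i ≤ 4 ^ I.size := by
  have h := I.abs_entry_le (2 + I.n * I.n + I.m * I.n + i)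
  rw [bv, ← abs_mul_abs_self, show (4 : ℤ) = 2 * 2 from rfl, mul_pow]
  gcongr

theorem abs_sum_range_le {k j : ℕ} {g : ℕ → ℤ} {G : ℤ} (hj : j ≤ k) (hG : 0 ≤ G)
    (hg : ∀ i < k, |g i| ≤ G) : |∑ i ∈ Finset.range j, g i| ≤ k * G := by
  calc |∑ i ∈ Finset.range j, g i| ≤ ∑ i ∈ Finset.range j, |g i| := Finset.abs_sum_le_sum_abs _ _
    _ ≤ ∑ _i ∈ Finset.range j, G := Finset.sum_le_sum fun i hi => hg i (by
        have := Finset.mem_range.1 hi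
        omega)
    _ = j * G := by simp
    _ ≤ k * G := by gcongr

theorem abs_rhsSq_le {j : ℕ} (hj : j ≤ I.m) :
    |∑ i ∈ Finset.range j, I.bv i * I.bv i| ≤ I.rhsBound := by
  refine (abs_sum_range_le hj (by positivity) (fun i _ => ?_)).trans
    (by unfold rhsBound; exact_mod_cast Nat.mul_le_mul_right _ I.m_le_size :
      (I.m : ℤ) * 4 ^ I.size ≤ I.rhsBound)
  rw [abs_mul_self]
  exact I.bv_sq_le i

theorem abs_bv_le (i : ℕ) : |I.bv i| ≤ I.rhsBound := by
  have h1 : |I.bv i| ≤ I.bv i * I.bv i := by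
    rw [← abs_mul_abs_self, ← pow_two]
    exact Int.le_self_sq _
  refine h1.trans ((I.bv_sq_le i).trans ?_)
  unfold rhsBound
  push_cast
  exact le_mul_of_one_le_left (by positivity) (by have := I.two_le_size; omega)

theorem abs_rhsMin_le (r i : ℕ) : |I.rhsMin r i| ≤ I.rhsBound := by
  induction i with
  | zero => exact I.abs_rhsSq_le le_rfl
  | succ i ih =>
    rw [rhsMin]
    split_ifs
    · exact ih
    · exact I.abs_bv_le i
    · exact ih

theorem digitBase_pos (n a : ℕ) : 0 < digitBase n a := Nat.succ_pos _

theorem abs_coeff_le (c i : ℕ) : |I.coeff c i| ≤ coeffMax I.n I.a := by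
  have h := Nat.mod_lt (c / digitBase I.n I.a ^ i) (digitBase_pos I.n I.a)
  rw [coeff, abs_le]
  have : digitBase I.n I.a = 2 * coeffMax I.n I.a + 1 := rfl
  constructor <;> omega

theorem abs_coeff_mul_rhsMin_le (c i r j : ℕ) :
    |I.coeff c i * I.rhsMin r j| ≤ coeffMax I.n I.a * I.rhsBound := by
  rw [abs_mul]
  gcongr
  · exact I.abs_coeff_le c i
  · exact I.abs_rhsMin_le r j

theorem abs_cand_sum_le (c k : ℕ) {j : ℕ} (hj : j ≤ rowCount I.n I.a) :
    |∑ r ∈ Finset.range j, I.coeff c (k * (rowCount I.n I.a + 2) + r) * I.rhsMin r I.m| ≤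
      rowCount I.n I.a * (coeffMax I.n I.a * I.rhsBound) :=
  abs_sum_range_le hj (by positivity) fun _ _ => I.abs_coeff_mul_rhsMin_le _ _ _ _

theorem cand_bound_aux : (rowCount I.n I.a * (coeffMax I.n I.a * I.rhsBound) + coeffMax I.n I.a : ℤ) ≤
    I.candBound := by
  have h1 := I.one_le_rhsBound
  have h2 : rowCount I.n I.a * coeffMax I.n I.a + coeffMax I.n I.a ≤ smallBound I.n I.a := by
    unfold smallBound; omega
  have h3 := Nat.mul_le_mul_right I.rhsBound h2
  unfold candBound
  have h4 : coeffMax I.n I.a ≤ coeffMax I.n I.a * I.rhsBound := Nat.le_mul_of_pos_right _ h1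
  exact_mod_cast (by nlinarith : rowCount I.n I.a * (coeffMax I.n I.a * I.rhsBound) + coeffMax I.n I.a ≤
    smallBound I.n I.a * I.rhsBound)

theorem abs_cand_num_le (c k : ℕ) :
    |∑ r ∈ Finset.range (rowCount I.n I.a), I.coeff c (k * (rowCount I.n I.a + 2) + r) * I.rhsMin r I.m +
      I.coeff c (k * (rowCount I.n I.a + 2) + rowCount I.n I.a)| ≤ I.candBound :=
  (abs_add_le _ _).trans ((add_le_add (I.abs_cand_sum_le c k le_rfl) (I.abs_coeff_le _ _)).trans
    I.cand_bound_aux)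

/-- Integer division never increases the absolute value. This includes division by zero, which
occurs for candidates whose denominator digit encodes zero. -/
theorem abs_cand_le (c k : ℕ) : |I.cand c k| ≤ I.candBound :=
  (Int.abs_ediv_le_abs _ _).trans (I.abs_cand_num_le c k)

theorem abs_av_le {i j : ℕ} (hi : i < I.m) (hj : j < I.n) : |I.av i j| ≤ I.a := by
  have h := I.av_eq ⟨i, hi⟩ ⟨j, hj⟩
  simp only at h
  rw [h]
  exact I.abs_A_le _ _

theorem abs_qv_le {i j : ℕ} (hi : i < I.n) (hj : j < I.n) : |I.qv i j| ≤ I.a := by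
  have h := I.qv_eq ⟨i, hi⟩ ⟨j, hj⟩
  simp only at h
  rw [h]
  exact I.abs_Q_le _ _

theorem abs_lhs_term_le (c : ℕ) {i j : ℕ} (hi : i < I.m) (hj : j < I.n) :
    |I.av i j * I.cand c j| ≤ I.a * I.candBound := by
  rw [abs_mul]
  gcongr
  · exact I.abs_av_le hi hj
  · exact I.abs_cand_le c j

theorem abs_lhs_le (c : ℕ) {i j : ℕ} (hi : i < I.m) (hj : j ≤ I.n) :
    |∑ l ∈ Finset.range j, I.av i l * I.cand c l| ≤ I.n * (I.a * I.candBound) :=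
  abs_sum_range_le hj (by positivity) fun _ hl => I.abs_lhs_term_le c hi hl

theorem abs_qv_mul_cand_le (c : ℕ) {i j : ℕ} (hi : i < I.n) (hj : j < I.n) :
    |I.qv i j * I.cand c j| ≤ I.a * I.candBound := by
  rw [abs_mul]
  gcongr
  · exact I.abs_qv_le hi hj
  · exact I.abs_cand_le c j

theorem abs_value_term_le (c : ℕ) {i j : ℕ} (hi : i < I.n) (hj : j < I.n) :
    |I.cand c i * (I.qv i j * I.cand c j)| ≤ I.candBound * (I.a * I.candBound) := by
  rw [abs_mul]
  gcongr
  · exact I.abs_cand_le c i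
  · exact I.abs_qv_mul_cand_le c hi hj

theorem abs_value_inner_le (c : ℕ) {i j : ℕ} (hi : i < I.n) (hj : j ≤ I.n) :
    |∑ l ∈ Finset.range j, I.cand c i * (I.qv i l * I.cand c l)| ≤
      I.n * (I.candBound * (I.a * I.candBound)) :=
  abs_sum_range_le hj (by positivity) fun _ hl => I.abs_value_term_le c hi hl

theorem abs_value_le (c : ℕ) {j : ℕ} (hj : j ≤ I.n) :
    |∑ i ∈ Finset.range j, ∑ l ∈ Finset.range I.n, I.cand c i * (I.qv i l * I.cand c l)| ≤
      I.n * (I.n * (I.candBound * (I.a * I.candBound))) :=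
  abs_sum_range_le hj (by positivity) fun _ hi => I.abs_value_inner_le c hi le_rfl

theorem abs_violated_le (c : ℕ) {j : ℕ} (hj : j ≤ I.m) :
    |∑ i ∈ Finset.range j, if 0 < I.lhs c i - I.bv i then (1 : ℤ) else 0| ≤ I.rhsBound := by
  refine (abs_sum_range_le hj zero_le_one (fun i _ => ?_)).trans
    (by exact_mod_cast (by simpa using I.m_le_size.trans I.size_le_rhsBound))
  split_ifs <;> simp

theorem best_lt (j : ℕ) (hj : 0 < j) : I.best j < j := by
  induction j with
  | zero => omega
  | succ j ih =>
    rcases Nat.eq_zero_or_pos j with rfl | h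
    · rw [best]; simp [best]
    · have := ih h
      rw [best]
      split_ifs <;> omega

theorem candCount_pos (n a : ℕ) : 0 < candCount n a := Nat.pow_pos (digitBase_pos n a)

end IQP

/-! ## The terms of the algorithm -/

namespace RAM

namespace Term

/-- The sum of `f i` for `i < N`. -/
def sum (N : Term) (f : Term → Term) : Term := fold N (lit 0) fun i s => s + f i

/-- The power `b ^ e`. -/
def pow (b e : Term) : Term := fold e (lit 1) fun _ s => s * b

/-- The number of variables. -/
def nT : Term := load (lit 0)

/-- The number of constraints. -/
def mT : Term := load (lit 1)

/-- The square of the largest absolute value of a coefficient. -/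
def aT : Term := fold (nT * nT + mT * nT) (lit 0) fun i s =>
  ifpos (load (lit 2 + i) * load (lit 2 + i) - s) (load (lit 2 + i) * load (lit 2 + i)) s

/-- The bound on the coefficients of the candidates. -/
def coeffMaxT : Term := fold (nT + lit 1) (lit 1) fun _ s =>
  pow (lit 4 * (nT + lit 1) * (aT + lit 1) * s) (lit 2 * nT + lit 2)

/-- The base of the row codes. -/
def rowBaseT : Term := lit 2 * aT + lit 1

/-- The number of row codes. -/
def rowCountT : Term := pow rowBaseT nT

/-- The number of values of a coefficient. -/
def digitBaseT : Term := lit 2 * coeffMaxT + lit 1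

/-- The number of coefficients of a candidate. -/
def digitCountT : Term := nT * (rowCountT + lit 2)

/-- The number of candidates. -/
def candCountT : Term := pow digitBaseT digitCountT

/-- An entry of `Q`. -/
def qT (i j : Term) : Term := load (lit 2 + (i * nT + j))

/-- An entry of `A`. -/
def entryT (i j : Term) : Term := load (lit 2 + nT * nT + (i * nT + j))

/-- An entry of `b`. -/
def bT (i : Term) : Term := load (lit 2 + nT * nT + mT * nT + i)

/-- The code of a row of `A`. -/
def rowCodeT (i : Term) : Term := sum nT fun j => (entryT i j + aT) * pow rowBaseT j

/-- The strongest bound on the row with a given code. -/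
def rhsMinT (r : Term) : Term := fold mT (sum mT fun i => bT i * bT i) fun i s =>
  ifpos ((rowCodeT i - r) * (rowCodeT i - r)) s (ifpos (s - bT i) (bT i) s)

/-- A coefficient of a candidate. -/
def coeffT (c i : Term) : Term :=
  c / pow digitBaseT i - c / pow digitBaseT i / digitBaseT * digitBaseT - coeffMaxT

/-- A coordinate of a candidate. -/
def candT (c k : Term) : Term :=
  ((sum rowCountT fun r => coeffT c (k * (rowCountT + lit 2) + r) * rhsMinT r) +
    coeffT c (k * (rowCountT + lit 2) + rowCountT)) /
      coeffT c (k * (rowCountT + lit 2) + (rowCountT + lit 1))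

/-- The number of constraints that a candidate violates. -/
def violatedT (c : Term) : Term := sum mT fun i =>
  ifpos ((sum nT fun j => entryT i j * candT c j) - bT i) (lit 1) (lit 0)

/-- The value of a candidate. -/
def valueT (c : Term) : Term := sum nT fun i => sum nT fun j => candT c i * (qT i j * candT c j)

/-- The best candidate. -/
def bestT : Term := fold candCountT (lit 0) fun c s =>
  ifpos (violatedT c) s (ifpos (violatedT s) c (ifpos (valueT s - valueT c) c s))

/-- The length of the input. -/
def lenT : Term := lit 2 + nT * nT + mT * nT + mT

end Term

open Term

/-! ### Evaluation of natural number operations, sums and powers -/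

section General

variable {U : ℕ} {H : (ℕ → ℤ) → Prop} {d : ℕ} {ρ : ℕ → ℤ} {a b : Term}

theorem Den.congr {v w : ℤ} (h : Den U H d ρ a v) (e : v = w) : Den U H d ρ a w := e ▸ h

theorem Den.nat_add {u v : ℕ} (hU : 8 ≤ U) (ha : Den U H d ρ a u) (hb : Den U H d ρ b v)
    (h : bitLen (u + v : ℕ) ≤ U) : Den U H d ρ (a + b) (u + v : ℕ) := by
  push_cast at h ⊢
  exact ha.add hU hb h

theorem Den.nat_mul {u v : ℕ} (hU : 8 ≤ U) (ha : Den U H d ρ a u) (hb : Den U H d ρ b v)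
    (h : bitLen (u * v : ℕ) ≤ U) : Den U H d ρ (a * b) (u * v : ℕ) := by
  push_cast at h ⊢
  exact ha.mul hU hb h

theorem Den.nat_div {u v : ℕ} (hU : 8 ≤ U) (ha : Den U H d ρ a u) (hb : Den U H d ρ b v) :
    Den U H d ρ (a / b) (u / v : ℕ) := by
  push_cast
  exact ha.div hU hb

theorem Den.nat_lit {v : ℕ} (h : bitLen v ≤ U) : Den U H d ρ (Term.lit v) v := Den.lit h

theorem Den.sum (hU : 8 ≤ U) {N : Term} {f : Term → Term} {k : ℕ} {g : ℕ → ℤ}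
    (hN : Den U H d ρ N k) (hk : k ≤ U)
    (hf : ∀ i < k, ∀ d' ρ' x, d ≤ d' → (∀ l < d, ρ' l = ρ l) → Den U H d' ρ' x i →
      Den U H d' ρ' (f x) (g i))
    (hg : ∀ j ≤ k, bitLen (∑ i ∈ Finset.range j, g i) ≤ U)
    (hdeg : ∀ i, (f (.var i)).deg = (f (.var 0)).deg := by intros; rfl) :
    Den U H d ρ (Term.sum N f) (∑ i ∈ Finset.range k, g i) := by
  refine Den.fold (acc := fun j => ∑ i ∈ Finset.range j, g i) hU hN hk
    (Den.lit (by rw [bitLen_zero]; omega)) (fun i hi d' ρ' x y hd hρ hx hy => ?_) (fun i j => ?_)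
  · have h := hg (i + 1) hi
    simp only [Finset.sum_range_succ] at h ⊢
    exact hy.add hU (hf i hi d' ρ' x hd hρ hx) h
  · change (Term.var j).deg + (f (.var i)).deg + 3 = (Term.var 0).deg + (f (.var 0)).deg + 3
    rw [hdeg i]
    rfl

theorem Den.pow (hU : 8 ≤ U) {u v : ℕ} (ha : Den U H d ρ a u) (hb : Den U H d ρ b v) (hv : v ≤ U)
    (hu : 0 < u) (h : bitLen (u ^ v : ℕ) ≤ U) : Den U H d ρ (pow a b) (u ^ v : ℕ) := by
  refine Den.fold (acc := fun j => ((u ^ j : ℕ) : ℤ)) hU hb hv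
    (Den.congr (Den.lit (by rw [bitLen_one]; omega)) (by simp))
    (fun i hi d' ρ' x y hd hρ hx hy => ?_)
  have h1 := hy.nat_mul hU (ha.mono hd hρ) ((bitLen_mono (by
    rw [Nat.abs_cast, Nat.abs_cast, ← pow_succ]
    exact_mod_cast Nat.pow_le_pow_right hu hi)).trans h)
  rwa [← pow_succ] at h1

end General

end RAM

/-! ### Correctness and cost of the terms -/

namespace IQP

open RAM RAM.Term

variable (I : IQP)

/-- Evaluation of a term for the instance `I`. -/
abbrev Evals (d : ℕ) (ρ : ℕ → ℤ) (t : Term) (v : ℤ) : Prop := Den I.timeBase I.Holds d ρ t v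

variable {d : ℕ} {ρ : ℕ → ℤ} {x y : Term} {i j k r c : ℕ}

theorem evals_lit (h : k ≤ 10) : I.Evals d ρ (lit k) k :=
  Den.nat_lit (I.bitLen_nat_le_of_smallBound (h.trans (ten_le_smallBound _ _)))

theorem bitLen_entry_le (k : ℕ) : bitLen (I.entry k) ≤ I.timeBase :=
  I.bitLen_le_of_rhsBound ((I.abs_entry_le k).trans (by
    have h1 : 2 ^ I.size ≤ 4 ^ I.size := Nat.pow_le_pow_left (by omega) _
    have h2 : 4 ^ I.size ≤ I.rhsBound :=
      Nat.le_mul_of_pos_left _ (by have := I.two_le_size; omega)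
    exact_mod_cast h1.trans h2))

theorem Evals.load_entry (hx : I.Evals d ρ x k) (hk : k < I.len) :
    I.Evals d ρ (load x) (I.entry k) :=
  Den.load I.eight_le_timeBase hx (I.bitLen_entry_le k) fun _ h => h k hk

theorem evals_n : I.Evals d ρ nT I.n :=
  (Evals.load_entry I (k := 0) (I.evals_lit (by omega)) (by unfold len; omega)).congr I.entry_zero

theorem evals_m : I.Evals d ρ mT I.m :=
  (Evals.load_entry I (k := 1) (I.evals_lit (by omega)) (by unfold len; omega)).congr I.entry_one

theorem le_timeBase_of_le_smallBound (h : k ≤ smallBound I.n I.a) : k ≤ I.timeBase :=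
  h.trans I.smallBound_le_timeBase

theorem le_timeBase_of_le_len (h : k ≤ I.len) : k ≤ I.timeBase :=
  h.trans (I.len_le_size.trans I.size_le_timeBase)

theorem n_le : I.n ≤ I.timeBase :=
  I.le_timeBase_of_le_smallBound (by unfold smallBound; omega)

theorem m_le : I.m ≤ I.timeBase := I.le_timeBase_of_le_len (by unfold len; omega)

theorem evals_a : I.Evals d ρ aT I.a := by
  rw [← sqMax_eq]
  have hU := I.eight_le_timeBase
  have h1 : I.Evals d ρ (nT * nT + mT * nT) (I.n * I.n + I.m * I.n : ℕ) :=
    (I.evals_n.nat_mul hU I.evals_n (I.bitLen_nat_le_of_len (by unfold len; omega))).nat_add hU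
      (I.evals_m.nat_mul hU I.evals_n (I.bitLen_nat_le_of_len (by unfold len; omega)))
      (I.bitLen_nat_le_of_len (by unfold len; omega))
  refine Den.fold (acc := fun j => (I.sqMax j : ℤ)) hU h1
    (I.le_timeBase_of_le_len (by unfold len; omega))
    ((I.evals_lit (k := 0) (by omega)).congr (by simp [sqMax])) fun i hi d' ρ' x y hd hρ hx hy => ?_
  rw [sqMax_succ]
  have h2 : I.Evals d' ρ' (load (lit 2 + x)) (I.entry (2 + i)) :=
    Evals.load_entry I ((I.evals_lit (k := 2) (by omega)).nat_add hU hx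
      (I.bitLen_nat_le_of_len (by unfold len; omega))) (by unfold len; omega)
  have ha : I.a ≤ smallBound I.n I.a := by unfold smallBound; omega
  have h3 : I.entry (2 + i) * I.entry (2 + i) ≤ I.a := by
    rw [← Int.natAbs_mul_self, ← pow_two]
    exact_mod_cast Nat.pow_le_pow_left (I.natAbs_coeff_le hi) 2
  have h4 : (0 : ℤ) ≤ I.entry (2 + i) * I.entry (2 + i) := mul_self_nonneg _
  have h5 := h2.mul hU h2 (I.bitLen_le_of_smallBound (by rw [abs_of_nonneg h4]; omega))
  have h6 := I.sqMax_le hi.le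
  exact Den.ifpos hU (h5.sub hU hy (I.bitLen_le_of_smallBound (by rw [abs_le]; constructor <;> omega)))
    (fun _ => h5) fun _ => hy

theorem evals_coeffMax : I.Evals d ρ coeffMaxT (coeffMax I.n I.a : ℕ) := by
  have hU := I.eight_le_timeBase
  have hn : I.n ≤ I.n * I.n := Nat.le_mul_self _
  have hnS : 2 * I.n + 2 ≤ smallBound I.n I.a := by unfold smallBound; omega
  have hn1 : I.Evals d ρ (nT + lit 1) (I.n + 1 : ℕ) :=
    I.evals_n.nat_add hU (I.evals_lit (k := 1) (by omega)) (I.bitLen_nat_le_of_smallBound (by omega))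
  refine Den.fold (acc := fun t => (coeffBound I.n I.a t : ℤ)) hU hn1
    (I.le_timeBase_of_le_smallBound (by omega))
    ((I.evals_lit (k := 1) (by omega)).congr (by simp [coeffBound]))
    fun t ht d' ρ' x y hd hρ hx hy => ?_
  have hK : coeffBound I.n I.a (t + 1) ≤ smallBound I.n I.a :=
    (coeffBound_mono I.n I.a ht).trans (by unfold smallBound coeffMax; omega)
  have hK1 := one_le_coeffBound I.n I.a t
  have h1 : 4 * (I.n + 1) * (I.a + 1) * coeffBound I.n I.a t ≤ coeffBound I.n I.a (t + 1) :=
    Nat.le_self_pow (by omega) _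
  have h2 : 4 * (I.n + 1) * (I.a + 1) ≤ 4 * (I.n + 1) * (I.a + 1) * coeffBound I.n I.a t :=
    Nat.le_mul_of_pos_right _ hK1
  have h3 : 4 * (I.n + 1) ≤ 4 * (I.n + 1) * (I.a + 1) := Nat.le_mul_of_pos_right _ (by omega)
  have ha : I.a + 1 ≤ 4 * (I.n + 1) * (I.a + 1) := Nat.le_mul_of_pos_left _ (by omega)
  have e1 : I.Evals d' ρ' (lit 4 * (nT + lit 1)) (4 * (I.n + 1) : ℕ) :=
    (I.evals_lit (k := 4) (by omega)).nat_mul hU (hn1.mono hd hρ)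
      (I.bitLen_nat_le_of_smallBound (by omega))
  have e2 : I.Evals d' ρ' (aT + lit 1) (I.a + 1 : ℕ) :=
    I.evals_a.nat_add hU (I.evals_lit (k := 1) (by omega)) (I.bitLen_nat_le_of_smallBound (by omega))
  have e3 := (e1.nat_mul hU e2 (I.bitLen_nat_le_of_smallBound (by omega))).nat_mul hU hy
    (I.bitLen_nat_le_of_smallBound (by omega))
  have e4 : I.Evals d' ρ' (lit 2 * nT + lit 2) (2 * I.n + 2 : ℕ) :=
    ((I.evals_lit (k := 2) (by omega)).nat_mul hU I.evals_n
      (I.bitLen_nat_le_of_smallBound (by omega))).nat_add hU (I.evals_lit (k := 2) (by omega))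
      (I.bitLen_nat_le_of_smallBound (by omega))
  exact e3.pow hU e4 (I.le_timeBase_of_le_smallBound (by omega)) (by positivity)
    (I.bitLen_nat_le_of_smallBound hK)

theorem rowCount_le : rowCount I.n I.a ≤ smallBound I.n I.a := by unfold smallBound; omega

theorem evals_rowBase_pow (hj : j ≤ I.n) (hx : I.Evals d ρ x j) :
    I.Evals d ρ (pow rowBaseT x) ((2 * I.a + 1) ^ j : ℕ) := by
  have hU := I.eight_le_timeBase
  have h1 : I.a ≤ smallBound I.n I.a := by unfold smallBound; omega
  -- The base `2a + 1` is not a summand of `smallBound`, and for `n = 0` the power `rowCount` does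
  -- not dominate it; the larger budget covers it.
  have h2 : ∀ z : ℕ, z ≤ 2 * I.a + 1 → bitLen z ≤ I.timeBase := fun z hz =>
    I.bitLen_le_of_mul_candBound (by
      rw [Nat.abs_cast]
      have h3 := I.smallBound_le_candBound
      have h4 := ten_le_smallBound I.n I.a
      exact_mod_cast hz.trans (by nlinarith))
  have e : I.Evals d ρ rowBaseT (2 * I.a + 1 : ℕ) :=
    ((I.evals_lit (k := 2) (by omega)).nat_mul hU I.evals_a (h2 _ (by omega))).nat_add hU
      (I.evals_lit (k := 1) (by omega)) (h2 _ (by omega))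
  refine e.pow hU hx (hj.trans I.n_le) (by omega) (I.bitLen_nat_le_of_smallBound ?_)
  exact (Nat.pow_le_pow_right (by omega) hj).trans I.rowCount_le

theorem evals_rowCount : I.Evals d ρ rowCountT (rowCount I.n I.a) :=
  I.evals_rowBase_pow le_rfl I.evals_n

theorem digitBase_le : digitBase I.n I.a ≤ smallBound I.n I.a := by unfold smallBound; omega

theorem evals_digitBase : I.Evals d ρ digitBaseT (digitBase I.n I.a) := by
  have hU := I.eight_le_timeBase
  have h := I.digitBase_le
  unfold digitBase at h ⊢
  exact ((I.evals_lit (k := 2) (by omega)).nat_mul hU I.evals_coeffMax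
    (I.bitLen_nat_le_of_smallBound (by omega))).nat_add hU (I.evals_lit (k := 1) (by omega))
    (I.bitLen_nat_le_of_smallBound h)

theorem candCount_le : candCount I.n I.a ≤ smallBound I.n I.a := by unfold smallBound; omega

theorem digitCount_le : digitCount I.n I.a ≤ smallBound I.n I.a := by unfold smallBound; omega

theorem evals_digitBase_pow (hj : j ≤ digitCount I.n I.a) (hx : I.Evals d ρ x j) :
    I.Evals d ρ (pow digitBaseT x) (digitBase I.n I.a ^ j : ℕ) :=
  I.evals_digitBase.pow I.eight_le_timeBase hx
    (I.le_timeBase_of_le_smallBound (hj.trans I.digitCount_le)) (digitBase_pos _ _)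
    (I.bitLen_nat_le_of_smallBound
      ((Nat.pow_le_pow_right (digitBase_pos _ _) hj).trans I.candCount_le))

theorem evals_rowCount_add_two : I.Evals d ρ (rowCountT + lit 2) (rowCount I.n I.a + 2 : ℕ) :=
  I.evals_rowCount.nat_add I.eight_le_timeBase (I.evals_lit (k := 2) (by omega))
    (I.bitLen_nat_le_of_smallBound (by unfold smallBound; omega))

theorem evals_candCount : I.Evals d ρ candCountT (candCount I.n I.a) :=
  I.evals_digitBase_pow le_rfl (I.evals_n.nat_mul I.eight_le_timeBase I.evals_rowCount_add_two
    (I.bitLen_nat_le_of_smallBound I.digitCount_le))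

theorem evals_q (hi : i < I.n) (hj : j < I.n) (hx : I.Evals d ρ x i) (hy : I.Evals d ρ y j) :
    I.Evals d ρ (qT x y) (I.qv i j) := by
  have hU := I.eight_le_timeBase
  have h : i * I.n + j < I.n * I.n := by nlinarith
  exact Evals.load_entry I ((I.evals_lit (k := 2) (by omega)).nat_add hU
    ((hx.nat_mul hU I.evals_n (I.bitLen_nat_le_of_len (by unfold len; omega))).nat_add hU hy
      (I.bitLen_nat_le_of_len (by unfold len; omega)))
      (I.bitLen_nat_le_of_len (by unfold len; omega))) (by unfold len; omega)

theorem evals_entry (hi : i < I.m) (hj : j < I.n) (hx : I.Evals d ρ x i) (hy : I.Evals d ρ y j) :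
    I.Evals d ρ (entryT x y) (I.av i j) := by
  have hU := I.eight_le_timeBase
  have h : i * I.n + j < I.m * I.n := by nlinarith
  exact Evals.load_entry I (((I.evals_lit (k := 2) (by omega)).nat_add hU
    (I.evals_n.nat_mul hU I.evals_n (I.bitLen_nat_le_of_len (by unfold len; omega)))
      (I.bitLen_nat_le_of_len (by unfold len; omega))).nat_add hU
    ((hx.nat_mul hU I.evals_n (I.bitLen_nat_le_of_len (by unfold len; omega))).nat_add hU hy
      (I.bitLen_nat_le_of_len (by unfold len; omega)))
      (I.bitLen_nat_le_of_len (by unfold len; omega))) (by unfold len; omega)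

theorem evals_rhs_start : I.Evals d ρ (lit 2 + nT * nT + mT * nT)
    (2 + I.n * I.n + I.m * I.n : ℕ) := by
  have hU := I.eight_le_timeBase
  exact ((I.evals_lit (k := 2) (by omega)).nat_add hU
    (I.evals_n.nat_mul hU I.evals_n (I.bitLen_nat_le_of_len (by unfold len; omega)))
      (I.bitLen_nat_le_of_len (by unfold len; omega))).nat_add hU
    (I.evals_m.nat_mul hU I.evals_n (I.bitLen_nat_le_of_len (by unfold len; omega)))
      (I.bitLen_nat_le_of_len (by unfold len; omega))

theorem evals_b (hi : i < I.m) (hx : I.Evals d ρ x i) : I.Evals d ρ (bT x) (I.bv i) :=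
  Evals.load_entry I (I.evals_rhs_start.nat_add I.eight_le_timeBase hx
    (I.bitLen_nat_le_of_len (by unfold len; omega))) (by unfold len; omega)

theorem evals_len : I.Evals d ρ lenT I.len :=
  I.evals_rhs_start.nat_add I.eight_le_timeBase I.evals_m (I.bitLen_nat_le_of_len (le_refl I.len))

/-- The shifted entries `av + a` lie between `0` and `2a`, so they are digits to the base `2a + 1`.
-/
theorem rowCode_sum_bounds (hi : i < I.m) (hj : j ≤ I.n) :
    0 ≤ ∑ l ∈ Finset.range j, (I.av i l + I.a) * (2 * I.a + 1) ^ l ∧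
      ∑ l ∈ Finset.range j, (I.av i l + I.a) * (2 * I.a + 1) ^ l < (2 * I.a + 1) ^ j := by
  induction j with
  | zero => simp
  | succ j ih =>
    have h := abs_le.1 (I.abs_av_le hi (j := j) (by omega))
    obtain ⟨h1, h2⟩ := ih (by omega)
    rw [Finset.sum_range_succ, pow_succ]
    have h3 : (0 : ℤ) < (2 * I.a + 1) ^ j := by positivity
    constructor
    · have : 0 ≤ (I.av i j + I.a) * (2 * I.a + 1) ^ j := mul_nonneg (by omega) h3.le
      omega
    · nlinarith

theorem rowCode_nonneg (hi : i < I.m) : 0 ≤ I.rowCode i := (I.rowCode_sum_bounds hi le_rfl).1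

theorem rowCode_lt (hi : i < I.m) : I.rowCode i < rowCount I.n I.a := by
  have := (I.rowCode_sum_bounds hi le_rfl).2
  unfold rowCount
  push_cast
  exact this

theorem evals_rowCode (hi : i < I.m) (hx : I.Evals d ρ x i) :
    I.Evals d ρ (rowCodeT x) (I.rowCode i) := by
  have hU := I.eight_le_timeBase
  have hR : ((2 * I.a + 1) ^ I.n : ℤ) ≤ smallBound I.n I.a := by exact_mod_cast I.rowCount_le
  have hpow : ∀ j ≤ I.n, ((2 * I.a + 1) ^ j : ℤ) ≤ smallBound I.n I.a := fun j hj =>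
    (pow_le_pow_right₀ (by omega) hj).trans hR
  refine Den.sum (g := fun j => (I.av i j + I.a) * (2 * I.a + 1) ^ j) hU I.evals_n I.n_le
    (fun j hj d' ρ' y hd hρ hy => ?_) (fun j hj => ?_)
  · have h := abs_le.1 (I.abs_av_le hi hj)
    have h1 := I.rowCode_sum_bounds hi (j := j) hj.le
    have h2 := (I.rowCode_sum_bounds hi (j := j + 1) hj).2
    rw [Finset.sum_range_succ] at h2
    have h3 := hpow (j + 1) hj
    have h4 : (0 : ℤ) ≤ (I.av i j + I.a) * (2 * I.a + 1) ^ j :=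
      mul_nonneg (by omega) (by positivity)
    have h5 : (I.a + I.a : ℕ) ≤ smallBound I.n I.a := by
      have := Nat.le_self_pow (by omega : I.n ≠ 0) (2 * I.a + 1)
      have := I.rowCount_le
      unfold rowCount at this
      omega
    have e := (I.evals_rowBase_pow hj.le hy).congr (w := (2 * I.a + 1) ^ j) (by push_cast; rfl)
    exact ((I.evals_entry hi hj (hx.mono hd hρ) hy).add hU I.evals_a
      (I.bitLen_le_of_smallBound (by rw [abs_le]; constructor <;> omega))).mul hU e
      (I.bitLen_le_of_smallBound (by rw [abs_of_nonneg h4]; omega))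
  · have h1 := I.rowCode_sum_bounds hi hj
    have h2 := hpow j hj
    exact I.bitLen_le_of_smallBound (by rw [abs_of_nonneg h1.1]; omega)

theorem evals_rhsMin (hr : r < rowCount I.n I.a) (hx : I.Evals d ρ x r) :
    I.Evals d ρ (rhsMinT x) (I.rhsMin r I.m) := by
  have hU := I.eight_le_timeBase
  have hS : rowCount I.n I.a * rowCount I.n I.a ≤ smallBound I.n I.a := by
    unfold smallBound; omega
  refine Den.fold (acc := I.rhsMin r) hU I.evals_m I.m_le ?_ fun i hi d' ρ' y z hd hρ hy hz => ?_
  · refine Den.sum (g := fun i => I.bv i * I.bv i) hU I.evals_m I.m_le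
      (fun i hi d' ρ' y hd hρ hy => ?_) fun j hj => I.bitLen_le_of_rhsBound (I.abs_rhsSq_le hj)
    refine (I.evals_b hi hy).mul hU (I.evals_b hi hy) (I.bitLen_le_of_rhsBound ?_)
    have h1 := I.bv_sq_le i
    rw [abs_mul_self]
    refine h1.trans ?_
    unfold rhsBound
    push_cast
    exact le_mul_of_one_le_left (by positivity) (by have := I.two_le_size; omega)
  · rw [rhsMin]
    have h1 := I.rowCode_nonneg hi
    have h2 := I.rowCode_lt hi
    have h3 : |I.rowCode i - r| ≤ rowCount I.n I.a := by rw [abs_le]; constructor <;> omega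
    have e1 := (I.evals_rowCode hi hy).sub hU (hx.mono hd hρ)
      (I.bitLen_le_of_smallBound (h3.trans (by exact_mod_cast I.rowCount_le)))
    have e2 := e1.mul hU e1 (I.bitLen_le_of_smallBound (by
      rw [abs_mul]
      exact (mul_le_mul h3 h3 (abs_nonneg _) (by positivity)).trans (by exact_mod_cast hS)))
    have e3 := I.evals_b hi hy
    have e4 := hz.sub hU e3 (I.bitLen_le_of_mul_candBound (by
      refine (abs_sub _ _).trans ((add_le_add (I.abs_rhsMin_le r i) (I.abs_bv_le i)).trans ?_)
      have h4 := I.rhsBound_le_candBound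
      have h5 := ten_le_smallBound I.n I.a
      exact_mod_cast (by nlinarith : I.rhsBound + I.rhsBound ≤ smallBound I.n I.a * I.candBound)))
    exact Den.ifpos hU e2 (fun _ => hz) fun _ => Den.ifpos hU e4 (fun _ => e3) fun _ => hz

theorem evals_coeff (hc : c < candCount I.n I.a) (hi : i < digitCount I.n I.a)
    (hx : I.Evals d ρ x c) (hy : I.Evals d ρ y i) : I.Evals d ρ (coeffT x y) (I.coeff c i) := by
  have hU := I.eight_le_timeBase
  have hcS := hc.le.trans I.candCount_le
  have e1 := hx.nat_div hU (I.evals_digitBase_pow hi.le hy)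
  have h1 : c / digitBase I.n I.a ^ i ≤ c := Nat.div_le_self _ _
  have hW := I.digitBase_le
  have hM := I.abs_coeff_le c i
  unfold coeff at hM ⊢
  generalize c / digitBase I.n I.a ^ i = q at *
  have h2 := Nat.div_add_mod' q (digitBase I.n I.a)
  have h3 := Nat.mod_lt q (digitBase_pos I.n I.a)
  have e2 := (e1.nat_div hU I.evals_digitBase).nat_mul hU I.evals_digitBase
    (I.bitLen_nat_le_of_smallBound (by omega))
  -- The machine has no remainder operation; the digit is obtained from a quotient and a product.
  have h4 : (q : ℤ) - (q / digitBase I.n I.a * digitBase I.n I.a : ℕ) = (q % digitBase I.n I.a : ℕ) := by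
    omega
  have e3 := e1.sub hU e2 (by rw [h4]; exact I.bitLen_nat_le_of_smallBound (by omega))
  rw [h4] at e3
  exact e3.sub hU I.evals_coeffMax (I.bitLen_le_of_smallBound (hM.trans (by
    exact_mod_cast (by unfold smallBound; omega : coeffMax I.n I.a ≤ smallBound I.n I.a))))

theorem evals_cand (hc : c < candCount I.n I.a) (hk : k < I.n)
    (hx : I.Evals d ρ x c) (hy : I.Evals d ρ y k) : I.Evals d ρ (candT x y) (I.cand c k) := by
  have hU := I.eight_le_timeBase
  have hlt : ∀ l < rowCount I.n I.a + 2, k * (rowCount I.n I.a + 2) + l < digitCount I.n I.a := by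
    intro l hl
    unfold digitCount
    nlinarith
  have hdS := I.digitCount_le
  have e0 : I.Evals d ρ (y * (rowCountT + lit 2)) (k * (rowCount I.n I.a + 2) : ℕ) :=
    hy.nat_mul hU I.evals_rowCount_add_two
      (I.bitLen_nat_le_of_smallBound (by have := hlt 0 (by omega); omega))
  have e1 : ∀ d' ρ' z, ∀ l < rowCount I.n I.a + 2, d ≤ d' → (∀ l < d, ρ' l = ρ l) →
      I.Evals d' ρ' z l → I.Evals d' ρ' (coeffT x (y * (rowCountT + lit 2) + z))
        (I.coeff c (k * (rowCount I.n I.a + 2) + l)) := fun d' ρ' z l hl hd hρ hz =>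
    I.evals_coeff hc (hlt l hl) (hx.mono hd hρ) ((e0.mono hd hρ).nat_add hU hz
      (I.bitLen_nat_le_of_smallBound (by have := hlt l hl; omega)))
  have hM : (coeffMax I.n I.a * I.rhsBound : ℤ) ≤ I.candBound := by
    unfold candBound
    have : coeffMax I.n I.a ≤ smallBound I.n I.a := by unfold smallBound; omega
    exact_mod_cast Nat.mul_le_mul_right _ this
  have e2 := Den.sum (N := rowCountT) (d := d) (ρ := ρ)
    (f := fun r => coeffT x (y * (rowCountT + lit 2) + r) * rhsMinT r)
    (g := fun r => I.coeff c (k * (rowCount I.n I.a + 2) + r) * I.rhsMin r I.m) hU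
    I.evals_rowCount (I.le_timeBase_of_le_smallBound I.rowCount_le)
    (fun r hr d' ρ' z hd hρ hz => (e1 d' ρ' z r (by omega) hd hρ hz).mul hU
      (I.evals_rhsMin hr hz)
      (I.bitLen_le_of_candBound ((I.abs_coeff_mul_rhsMin_le _ _ _ _).trans hM)))
    (fun j hj => I.bitLen_le_of_candBound ((I.abs_cand_sum_le c k hj).trans
      ((le_add_of_nonneg_right (by positivity)).trans I.cand_bound_aux)))
  have e3 := e1 d ρ _ _ (by omega : rowCount I.n I.a < rowCount I.n I.a + 2) le_rfl
    (fun _ _ => rfl) I.evals_rowCount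
  have e4 := e1 d ρ _ _ (by omega : rowCount I.n I.a + 1 < rowCount I.n I.a + 2) le_rfl
    (fun _ _ => rfl) (I.evals_rowCount.nat_add hU (I.evals_lit (k := 1) (by omega))
      (I.bitLen_nat_le_of_smallBound (by unfold smallBound; omega)))
  exact (e2.add hU e3 (I.bitLen_le_of_candBound (I.abs_cand_num_le c k))).div hU e4

theorem evals_violated (hc : c < candCount I.n I.a) (hx : I.Evals d ρ x c) :
    I.Evals d ρ (violatedT x) (I.violated c) := by
  have hU := I.eight_le_timeBase
  have hS : I.n * I.a + I.a + 1 ≤ smallBound I.n I.a := by unfold smallBound; omega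
  refine Den.sum (g := fun i => if 0 < I.lhs c i - I.bv i then (1 : ℤ) else 0) hU I.evals_m I.m_le
    (fun i hi d' ρ' y hd hρ hy => ?_) fun j hj => I.bitLen_le_of_rhsBound (I.abs_violated_le c hj)
  have h1 : (I.n * (I.a * I.candBound) : ℤ) ≤ (smallBound I.n I.a * I.candBound : ℕ) := by
    exact_mod_cast (by nlinarith : I.n * (I.a * I.candBound) ≤ smallBound I.n I.a * I.candBound)
  have h2 : (I.a * I.candBound : ℤ) ≤ (smallBound I.n I.a * I.candBound : ℕ) := by
    exact_mod_cast Nat.mul_le_mul_right I.candBound (by omega)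
  have h3 : (I.n * (I.a * I.candBound) + I.rhsBound : ℤ) ≤
      (smallBound I.n I.a * I.candBound : ℕ) := by
    have h4 := I.rhsBound_le_candBound
    exact_mod_cast (by nlinarith : I.n * (I.a * I.candBound) + I.rhsBound ≤
      smallBound I.n I.a * I.candBound)
  have e1 : I.Evals d' ρ' (sum nT fun j => entryT y j * candT x j) (I.lhs c i) :=
    Den.sum (g := fun j => I.av i j * I.cand c j) hU I.evals_n I.n_le
      (fun j hj d'' ρ'' z hd' hρ' hz => (I.evals_entry hi hj (hy.mono hd' hρ') hz).mul hU
        (I.evals_cand hc hj ((hx.mono hd hρ).mono hd' hρ') hz)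
        (I.bitLen_le_of_mul_candBound ((I.abs_lhs_term_le c hi hj).trans h2)))
      (fun j hj => I.bitLen_le_of_mul_candBound ((I.abs_lhs_le c hi hj).trans h1))
  refine Den.ifpos hU (e1.sub hU (I.evals_b hi hy) (I.bitLen_le_of_mul_candBound ?_))
    (fun _ => (I.evals_lit (k := 1) (by omega)).congr (by simp))
    fun _ => (I.evals_lit (k := 0) (by omega)).congr (by simp)
  exact (abs_sub _ _).trans ((add_le_add (I.abs_lhs_le c hi le_rfl) (I.abs_bv_le i)).trans h3)

theorem value_bound_aux : 2 * (I.n * (I.n * (I.candBound * (I.a * I.candBound)))) ≤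
    smallBound I.n I.a * I.candBound ^ 2 := by
  have h : 2 * (I.n * (I.n * I.a)) ≤ smallBound I.n I.a := by unfold smallBound; omega
  have := Nat.mul_le_mul_right (I.candBound ^ 2) h
  nlinarith

theorem evals_value (hc : c < candCount I.n I.a) (hx : I.Evals d ρ x c) :
    I.Evals d ρ (valueT x) (I.value c) := by
  have hU := I.eight_le_timeBase
  have h0 := I.value_bound_aux
  refine Den.sum (g := fun i => ∑ j ∈ Finset.range I.n, I.cand c i * (I.qv i j * I.cand c j)) hU
    I.evals_n I.n_le (fun i hi d' ρ' y hd hρ hy => ?_)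
    fun j hj => I.bitLen_le_timeBase ((I.abs_value_le c hj).trans (by exact_mod_cast (by omega)))
  have hn : 0 < I.n := by omega
  have h1 : I.n * (I.candBound * (I.a * I.candBound)) ≤
      I.n * (I.n * (I.candBound * (I.a * I.candBound))) := Nat.le_mul_of_pos_left _ hn
  have h2 : I.candBound * (I.a * I.candBound) ≤ I.n * (I.candBound * (I.a * I.candBound)) :=
    Nat.le_mul_of_pos_left _ hn
  have h3 : I.a * I.candBound ≤ I.candBound * (I.a * I.candBound) :=
    Nat.le_mul_of_pos_left _ (I.one_le_rhsBound.trans I.rhsBound_le_candBound)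
  refine Den.sum (g := fun j => I.cand c i * (I.qv i j * I.cand c j)) hU I.evals_n I.n_le
    (fun j hj d'' ρ'' z hd' hρ' hz => ?_) fun j hj => I.bitLen_le_timeBase
      ((I.abs_value_inner_le c hi hj).trans (by exact_mod_cast (by omega)))
  have hx' := (hx.mono hd hρ).mono hd' hρ'
  exact (I.evals_cand hc hi hx' (hy.mono hd' hρ')).mul hU
    ((I.evals_q hi hj (hy.mono hd' hρ') hz).mul hU (I.evals_cand hc hj hx' hz)
      (I.bitLen_le_timeBase ((I.abs_qv_mul_cand_le c hi hj).trans (by exact_mod_cast (by omega)))))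
    (I.bitLen_le_timeBase ((I.abs_value_term_le c hi hj).trans (by exact_mod_cast (by omega))))

theorem best_lt_candCount (hj : j ≤ candCount I.n I.a) : I.best j < candCount I.n I.a := by
  rcases Nat.eq_zero_or_pos j with rfl | h
  · exact candCount_pos _ _
  · exact (I.best_lt j h).trans_le hj

theorem evals_best : I.Evals d ρ bestT (I.best (candCount I.n I.a)) := by
  have hU := I.eight_le_timeBase
  refine Den.fold (acc := fun j => (I.best j : ℤ)) hU I.evals_candCount
    (I.le_timeBase_of_le_smallBound I.candCount_le) ((I.evals_lit (k := 0) (by omega)).congr rfl)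
    fun c hc d' ρ' x y hd hρ hx hy => ?_
  have hb := I.best_lt_candCount hc.le
  have h0 := I.value_bound_aux
  rw [best]
  push_cast
  refine Den.ifpos hU (I.evals_violated hc hx) (fun _ => hy) fun _ =>
    Den.ifpos hU (I.evals_violated hb hy) (fun _ => hx) fun _ =>
    Den.ifpos hU ((I.evals_value hb hy).sub hU (I.evals_value hc hx) (I.bitLen_le_timeBase ?_))
      (fun _ => hx) fun _ => hy
  refine (abs_sub _ _).trans ((add_le_add (I.abs_value_le _ le_rfl)
    (I.abs_value_le _ le_rfl)).trans ?_)
  rw [← two_mul]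
  exact_mod_cast h0

end IQP

/-! ## The best candidate is optimal -/

namespace IQP

variable (I : IQP)

/-- Uniqueness of digits: the lower part is smaller than one unit of the top digit, so the top
digits agree and can be cancelled. -/
theorem av_eq_of_rowCode_sum_eq {i i' : ℕ} (hi : i < I.m) (hi' : i' < I.m) (k : ℕ) (hk : k ≤ I.n)
    (h : ∑ l ∈ Finset.range k, (I.av i l + I.a) * (2 * I.a + 1) ^ l =
      ∑ l ∈ Finset.range k, (I.av i' l + I.a) * (2 * I.a + 1) ^ l) :
    ∀ j < k, I.av i j = I.av i' j := by
  induction k with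
  | zero => intro j hj; omega
  | succ k ih =>
    rw [Finset.sum_range_succ, Finset.sum_range_succ] at h
    obtain ⟨h1, h2⟩ := I.rowCode_sum_bounds hi (j := k) (by omega)
    obtain ⟨h3, h4⟩ := I.rowCode_sum_bounds hi' (j := k) (by omega)
    have hd : I.av i k = I.av i' k := by
      rcases lt_trichotomy (I.av i k) (I.av i' k) with hlt | heq | hgt
      · nlinarith
      · exact heq
      · nlinarith
    rw [hd] at h
    intro j hj
    rcases Nat.lt_succ_iff_lt_or_eq.1 hj with hj' | rfl
    · exact ih (by omega) (by omega) j hj'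
    · exact hd

theorem A_eq_of_rowCode_eq (i i' : Fin I.m) (h : I.rowCode i = I.rowCode i') : I.A i = I.A i' := by
  funext j
  rw [← av_eq, ← av_eq]
  exact I.av_eq_of_rowCode_sum_eq i.2 i'.2 I.n le_rfl h j j.2

theorem rhsMin_le {r i : ℕ} (h : I.rowCode i = r) (j : ℕ) (hij : i < j) :
    I.rhsMin r j ≤ I.bv i := by
  induction j with
  | zero => omega
  | succ j ih =>
    rw [rhsMin]
    rcases Nat.lt_succ_iff_lt_or_eq.1 hij with hj | rfl
    · have := ih hj
      split_ifs <;> omega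
    · rw [h]
      simp only [sub_self, mul_zero, lt_irrefl, if_false]
      split_ifs <;> omega

/-- Together with `rhsMin_le`, this shows that the computed numbers serve as the `T r` of the
candidate theorem. -/
theorem le_rhsMin {r : ℕ} {v : ℤ} (h0 : v ≤ I.rhsSq)
    (h : ∀ i < I.m, I.rowCode i = r → v ≤ I.bv i) (j : ℕ) (hj : j ≤ I.m) : v ≤ I.rhsMin r j := by
  induction j with
  | zero => exact h0
  | succ j ih =>
    rw [rhsMin]
    split_ifs with h1 h2
    · exact ih (by omega)
    · refine h j (by omega) ?_
      by_contra hne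
      exact h1 (mul_self_pos.2 (sub_ne_zero.2 hne))
    · exact ih (by omega)

/-- This is why the sum of squares can play the role of infinity as the starting value of the
minimum. -/
theorem bv_le_rhsSq {i : ℕ} (hi : i < I.m) : I.bv i ≤ I.rhsSq := by
  have h1 : I.bv i ≤ I.bv i * I.bv i := by
    rw [← pow_two]
    exact Int.le_self_sq _
  exact h1.trans (Finset.single_le_sum (f := fun i => I.bv i * I.bv i)
    (fun _ _ => mul_self_nonneg _) (Finset.mem_range.2 hi))

/-- Every digit string of length `digitCount` is the expansion of some number below `candCount`;
shifting by `coeffMax` makes the coefficients into digits. -/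
theorem exists_coeff_eq (co : ℕ → ℕ → ℤ) (hco : ∀ k l, |co k l| ≤ coeffMax I.n I.a) :
    ∃ c < candCount I.n I.a, ∀ k < I.n, ∀ l < rowCount I.n I.a + 2,
      I.coeff c (k * (rowCount I.n I.a + 2) + l) = co k l := by
  set R := rowCount I.n I.a + 2 with hR
  have hb : ∀ k l, (co k l + coeffMax I.n I.a).toNat < digitBase I.n I.a := fun k l => by
    have := abs_le.1 (hco k l)
    unfold digitBase
    omega
  let g : Fin (digitCount I.n I.a) → Fin (digitBase I.n I.a) := fun i =>
    ⟨(co (i / R) (i % R) + coeffMax I.n I.a).toNat, hb _ _⟩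
  refine ⟨finFunctionFinEquiv g, (finFunctionFinEquiv g).2, fun k hk l hl => ?_⟩
  have hlt : k * R + l < digitCount I.n I.a := by
    unfold digitCount
    nlinarith
  have h1 : ((finFunctionFinEquiv.symm (finFunctionFinEquiv g)) ⟨k * R + l, hlt⟩ : ℕ) =
      (g ⟨k * R + l, hlt⟩ : ℕ) := by rw [Equiv.symm_apply_apply]
  have h2 : ((finFunctionFinEquiv.symm (finFunctionFinEquiv g)) ⟨k * R + l, hlt⟩ : ℕ) =
      (finFunctionFinEquiv g : ℕ) / digitBase I.n I.a ^ (k * R + l) % digitBase I.n I.a := rfl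
  have hR0 : 0 < R := by omega
  have h3 : (k * R + l) / R = k := by
    rw [Nat.mul_comm, Nat.mul_add_div hR0, Nat.div_eq_of_lt hl, Nat.add_zero]
  have h4 : (k * R + l) % R = l := by
    rw [Nat.mul_add_mod_self_right, Nat.mod_eq_of_lt hl]
  rw [coeff, ← h2, h1]
  simp only [g, h3, h4]
  have := abs_le.1 (hco k l)
  rw [Int.toNat_of_nonneg (by omega)]
  omega

/-- Each coordinate owns a block of `rowCount + 2` digits: the weights, then the constant term, then
the denominator. For the right digits the division in `cand` is exact. -/
theorem exists_cand_eq {x : Fin I.n → ℤ} (hx : ∀ k, ∃ (w : Fin (rowCount I.n I.a) → ℤ) (c D : ℤ),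
      (∀ r, |w r| ≤ coeffBound I.n I.a (I.n + 1)) ∧ |c| ≤ coeffBound I.n I.a (I.n + 1) ∧
      |D| ≤ coeffBound I.n I.a (I.n + 1) ∧ D ≠ 0 ∧ D * x k = ∑ r, w r * I.rhsMin r I.m + c) :
    ∃ c < candCount I.n I.a, ∀ k : Fin I.n, I.cand c k = x k := by
  choose w v D hw hv hD hD0 hx using hx
  obtain ⟨c, hc, h⟩ := I.exists_coeff_eq (fun k l => if hk : k < I.n then
      if hl : l < rowCount I.n I.a then w ⟨k, hk⟩ ⟨l, hl⟩
      else if l = rowCount I.n I.a then v ⟨k, hk⟩ else D ⟨k, hk⟩ else 0) (by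
    intro k l
    split_ifs
    · exact hw _ _
    · exact hv _
    · exact hD _
    · simp)
  refine ⟨c, hc, fun k => ?_⟩
  have h' := h k k.2
  simp only [k.2, dif_pos, Fin.eta] at h'
  rw [cand, h' _ (by omega), h' _ (by omega), dif_neg (lt_irrefl _), if_pos rfl,
    dif_neg (by omega), if_neg (by omega), Finset.sum_range]
  have h1 : ∑ r : Fin (rowCount I.n I.a), I.coeff c (k * (rowCount I.n I.a + 2) + r) *
      I.rhsMin r I.m = ∑ r, w k r * I.rhsMin r I.m := by
    refine Finset.sum_congr rfl fun r _ => ?_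
    rw [h' _ (by omega), dif_pos r.2]
  rw [h1, ← hx, Int.mul_ediv_cancel_left _ (hD0 k)]

/-- The candidates do not depend on `Q` beyond the bound on its entries, so the same list serves for
`I.Q` and for the zero matrix. -/
theorem exists_cand_isMinimizer (Q : Matrix (Fin I.n) (Fin I.n) ℤ) (hQ : ∀ i j, |Q i j| ≤ I.a)
    {x : Fin I.n → ℤ} (hx : IsMinimizer Q I.A I.b x) :
    ∃ c < candCount I.n I.a, IsMinimizer Q I.A I.b fun k => I.cand c k := by
  have hcode : ∀ i : Fin I.m, ((I.rowCode i).toNat : ℤ) = I.rowCode i := fun i =>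
    Int.toNat_of_nonneg (I.rowCode_nonneg i.2)
  obtain ⟨z, hz, hrep⟩ := IsMinimizer.exists_candidate
    (T := fun r : Fin (rowCount I.n I.a) => I.rhsMin r I.m)
    (code := fun i => ⟨(I.rowCode i).toNat, by have := I.rowCode_lt i.2; have := hcode i; omega⟩)
    hQ I.abs_A_le (fun i => (I.rhsMin_le (hcode i).symm _ i.2).trans_eq (I.bv_eq i))
    (fun y hy i => I.le_rhsMin (((hy i).trans_eq (I.bv_eq i).symm).trans (I.bv_le_rhsSq i.2))
      (fun i' hi' h => by
        have h1 := I.A_eq_of_rowCode_eq ⟨i', hi'⟩ i (h.trans (hcode i))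
        have h2 := hy ⟨i', hi'⟩
        rw [← bv_eq] at h2
        refine le_trans (le_of_eq ?_) h2
        simp only [mulVec, h1]) _ le_rfl) hx
  obtain ⟨c, hc, h⟩ := I.exists_cand_eq hrep
  exact ⟨c, hc, by rwa [show (fun k : Fin I.n => I.cand c k) = z from funext h]⟩

theorem lhs_eq (c : ℕ) (i : Fin I.m) : I.lhs c i = (I.A *ᵥ fun k => I.cand c k) i := by
  rw [lhs, Finset.sum_range]
  simp only [av_eq]
  rfl

theorem violated_pos_iff (c : ℕ) : 0 < I.violated c ↔ ¬ I.Feasible fun k => I.cand c k := by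
  have h0 : ∀ i ∈ Finset.range I.m, (0 : ℤ) ≤ if 0 < I.lhs c i - I.bv i then 1 else 0 :=
    fun i _ => by split_ifs <;> simp
  rw [violated, (Finset.sum_nonneg h0).lt_iff_ne', Ne, not_iff_not,
    Finset.sum_eq_zero_iff_of_nonneg h0]
  constructor
  · intro h i
    have h1 := h i (Finset.mem_range.2 i.2)
    rw [← lhs_eq, ← bv_eq]
    refine not_lt.1 fun h2 => ?_
    rw [if_pos (sub_pos.2 h2)] at h1
    simp at h1
  · intro h i hi
    have h1 := h ⟨i, Finset.mem_range.1 hi⟩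
    rw [← lhs_eq, ← bv_eq] at h1
    exact if_neg (not_lt.2 (sub_nonpos.2 h1))

theorem value_eq (c : ℕ) : I.value c = I.objective fun k => I.cand c k := by
  rw [value, Finset.sum_range, objective, dotProduct]
  refine Finset.sum_congr rfl fun i _ => ?_
  rw [Finset.sum_range, mulVec, dotProduct, Finset.mul_sum]
  simp only [qv_eq]

/-- The search may start from an infeasible candidate; it is replaced by the first feasible one, and
from then on feasibility is kept and the value never increases. -/
theorem best_spec {c j : ℕ} (hc : c < j) (hf : I.Feasible fun k => I.cand c k) :
    (I.Feasible fun k => I.cand (I.best j) k) ∧ I.value (I.best j) ≤ I.value c := by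
  induction j with
  | zero => omega
  | succ j ih =>
    rw [best]
    rcases Nat.lt_succ_iff_lt_or_eq.1 hc with hj | rfl
    · obtain ⟨h1, h2⟩ := ih hj
      have h3 : ¬ 0 < I.violated (I.best j) := fun h => (I.violated_pos_iff _).1 h h1
      rw [if_neg h3]
      split_ifs with h4 h5
      · exact ⟨h1, h2⟩
      · rw [violated_pos_iff, not_not] at h4
        exact ⟨h4, by omega⟩
      · exact ⟨h1, h2⟩
    · have h3 : ¬ 0 < I.violated c := fun h => (I.violated_pos_iff _).1 h hf
      rw [if_neg h3]
      split_ifs with h4 h5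
      · exact ⟨hf, le_rfl⟩
      · exact ⟨hf, le_rfl⟩
      · rw [violated_pos_iff, not_not] at h4
        exact ⟨h4, by omega⟩

/-- The output of the algorithm. -/
def output (k : Fin I.n) : ℤ := I.cand (I.best (candCount I.n I.a)) k

theorem feasible_output (h : ∃ y, I.Feasible y) : I.Feasible I.output := by
  obtain ⟨y, hy⟩ := h
  -- For the zero objective any feasible point is a minimizer, so some candidate is feasible even if
  -- the instance is unbounded.
  obtain ⟨c, hc, hm⟩ := I.exists_cand_isMinimizer 0 (by simp) (x := y) ⟨hy, fun z _ => by simp⟩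
  exact (I.best_spec hc hm.1).1

theorem isOptimal_output (h : ∃ y, I.Feasible y) (hb : ¬ I.Unbounded) : I.IsOptimal I.output := by
  obtain ⟨y, hy⟩ := h
  unfold Unbounded at hb
  push Not at hb
  obtain ⟨β, hβ⟩ := hb
  -- A nonempty set of integers that is bounded below has a least element, so a minimizer exists.
  obtain ⟨v, ⟨x, hx, rfl⟩, hmin⟩ := Int.exists_least_of_bdd
    (P := fun v => ∃ x, I.Feasible x ∧ I.objective x = v)
    ⟨β, by rintro v ⟨x, hx, rfl⟩; exact (hβ x hx).le⟩ ⟨_, y, hy, rfl⟩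
  obtain ⟨c, hc, hm⟩ := I.exists_cand_isMinimizer I.Q I.abs_Q_le (x := x)
    ⟨hx, fun z hz => hmin _ ⟨z, hz, rfl⟩⟩
  obtain ⟨h1, h2⟩ := I.best_spec hc hm.1
  rw [value_eq, value_eq] at h2
  exact ⟨h1, fun z hz => h2.trans (hm.2 z hz)⟩

end IQP

/-! ## The program -/

namespace RAM

open Term

/-- Increase the counter in register 3 and update the number of remaining rounds. -/
def nextRound : Prog :=
  .seq (.const 6 1) <| .seq (.arith .add 3 3 6) (.arith .sub 4 0 3)

/-- Write a coordinate of the best candidate behind the input. -/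
def writeBody : Prog :=
  .seq ((candT (var 1) (var 3)).code 5) <| .seq (.arith .add 6 2 3) <| .seq (.store 6 5) nextRound

/-- Copy a coordinate of the best candidate to its place in the output. -/
def copyBody : Prog :=
  .seq (.arith .add 6 2 3) <| .seq (.load 5 6) <| .seq (.store 3 5) nextRound

/-- Compute the best candidate, write it behind the input, and copy it to the output. -/
def solver : Prog :=
  .seq (nT.code 0) <| .seq (bestT.code 1) <| .seq (lenT.code 2) <|
  .seq (.const 3 0) <| .seq (.arith .sub 4 0 3) <| .seq (.loop 4 writeBody) <|
  .seq (.const 3 0) <| .seq (.arith .sub 4 0 3) (.loop 4 copyBody)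

/-- The state at the beginning of round `i` of one of the output loops. -/
structure OutputState (n b l i : ℕ) (M : ℕ → ℤ) (s : State) : Prop where
  reg_zero : s.reg 0 = n
  reg_one : s.reg 1 = b
  reg_two : s.reg 2 = l
  reg_three : s.reg 3 = i
  reg_four : s.reg 4 = n - i
  mem_eq : s.mem = M

/-- Both output loops have the same control structure and differ only in the family `M` of memory
contents after each round. -/
theorem exec_output_loop {n b l U τ : ℕ} {M : ℕ → ℕ → ℤ} {P : Prog} (hn : bitLen n ≤ U)
    (hP : ∀ i < n, ∀ s, OutputState n b l i (M i) s →
      ∃ s' t, Exec P s s' t ∧ t ≤ τ ∧ OutputState n b l (i + 1) (M (i + 1)) s')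
    (r : ℕ) : ∀ i, i + r = n → ∀ s, OutputState n b l i (M i) s →
      ∃ s' t, Exec (.loop 4 P) s s' t ∧ t ≤ r * (U + τ) + U ∧ OutputState n b l n (M n) s' := by
  induction r with
  | zero =>
    intro i hi s hs
    obtain rfl : i = n := by omega
    refine ⟨s, _, Exec.loop_nonpos (by rw [hs.reg_four]; omega), ?_, hs⟩
    rw [hs.reg_four, sub_self, bitLen_zero]
    have : 1 ≤ bitLen (i : ℤ) := Nat.le_add_left _ _
    omega
  | succ r ih =>
    intro i hi s hs
    obtain ⟨s1, t1, x1, h1, hs1⟩ := hP i (by omega) s hs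
    obtain ⟨s2, t2, x2, h2, hs2⟩ := ih (i + 1) (by omega) s1 hs1
    refine ⟨s2, _, Exec.loop_pos (by rw [hs.reg_four]; omega) x1 x2, ?_, hs2⟩
    have h3 : bitLen (n - i : ℤ) ≤ U := (bitLen_mono (by
      rw [Nat.abs_cast, abs_of_nonneg (by omega)]
      omega)).trans hn
    rw [hs.reg_four]
    nlinarith

theorem exec_nextRound {n b l i U : ℕ} {M : ℕ → ℤ} {s : State} (hn : bitLen n ≤ U)
    (hi : i < n) (h0 : s.reg 0 = n) (h1 : s.reg 1 = b) (h2 : s.reg 2 = l) (h3 : s.reg 3 = i)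
    (hm : s.mem = M) :
    ∃ s' t, Exec nextRound s s' t ∧ t ≤ 3 * U + 4 ∧ OutputState n b l (i + 1) M s' := by
  have c1 : bitLen (i : ℤ) ≤ U := (bitLen_mono (by
    rw [Nat.abs_cast, Nat.abs_cast]; omega)).trans hn
  have c2 : bitLen (i + 1 : ℤ) ≤ U := (bitLen_mono (by
    rw [Nat.abs_cast, abs_of_nonneg (by omega)]; omega)).trans hn
  refine ⟨_, _, (Exec.const s 6 1).seq ((Exec.arith _ .add 3 3 6).seq (Exec.arith _ .sub 4 0 3)),
    ?_, ?_, ?_, ?_, ?_, ?_, ?_⟩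
  · simp [State.setReg, Op.cost, Op.eval, Function.update, h0, h3, bitLen_one]
    omega
  all_goals simp [State.setReg, Op.eval, h0, h1, h2, h3, hm]

end RAM

/-! ### Writing the output -/

namespace IQP

open RAM RAM.Term

variable (I : IQP)

/-- The index of the best candidate. -/
def bestIndex : ℕ := I.best (candCount I.n I.a)

theorem bestIndex_lt : I.bestIndex < candCount I.n I.a := I.best_lt_candCount le_rfl

/-- The memory after `i` rounds of the first output loop. -/
def writeMem (i p : ℕ) : ℤ :=
  if I.len ≤ p ∧ p < I.len + i then I.cand I.bestIndex (p - I.len) else I.entry p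

/-- The memory after `i` rounds of the second output loop. -/
def copyMem (i p : ℕ) : ℤ := if p < i then I.cand I.bestIndex p else I.writeMem I.n p

theorem n_lt_len : I.n < I.len := by
  have : I.n ≤ I.n * I.n := Nat.le_mul_self _
  unfold len
  omega

theorem bitLen_n_le : bitLen I.n ≤ I.timeBase :=
  I.bitLen_nat_le_of_len I.n_lt_len.le

theorem bitLen_len_add_le {i : ℕ} (hi : i < I.n) : bitLen (I.len + i : ℤ) ≤ I.timeBase := by
  refine I.bitLen_le_of_mul_candBound ?_
  have h1 := I.n_lt_len
  have h2 := I.len_le_size.trans (I.size_le_rhsBound.trans I.rhsBound_le_candBound)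
  have h3 := ten_le_smallBound I.n I.a
  rw [abs_of_nonneg (by positivity)]
  exact_mod_cast (by nlinarith : I.len + i ≤ smallBound I.n I.a * I.candBound)

theorem exec_writeBody {i : ℕ} (hi : i < I.n) {s : State}
    (hs : OutputState I.n I.bestIndex I.len i (I.writeMem i) s) :
    ∃ s' t, Exec writeBody s s' t ∧ t ≤ I.timeBase ^ ((candT (var 1) (var 3)).deg + 3) ∧
      OutputState I.n I.bestIndex I.len (i + 1) (I.writeMem (i + 1)) s' := by
  have hU := I.eight_le_timeBase
  have hb : bitLen I.bestIndex ≤ I.timeBase :=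
    I.bitLen_nat_le_of_smallBound (I.bestIndex_lt.le.trans I.candCount_le)
  have hil : bitLen i ≤ I.timeBase := I.bitLen_nat_le_of_len (hi.trans I.n_lt_len).le
  have hl : bitLen I.len ≤ I.timeBase := I.bitLen_nat_le_of_len le_rfl
  have e1 : I.Evals 5 s.reg (var 1) I.bestIndex := by
    rw [← hs.reg_one]
    exact Den.var (by omega) (by omega) (by rwa [hs.reg_one])
  have e2 : I.Evals 5 s.reg (var 3) i := by
    rw [← hs.reg_three]
    exact Den.var (by omega) (by omega) (by rwa [hs.reg_three])
  have e3 := I.evals_cand I.bestIndex_lt hi e1 e2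
  -- Earlier rounds wrote only at addresses from `len` on, so the instance is intact and the next
  -- coordinate can still be computed from it.
  obtain ⟨s1, t1, x1, h1, r1, m1, k1⟩ := e3.2 5 s le_rfl (fun _ _ => rfl) (by
    intro k hk
    rw [hs.mem_eq, writeMem, if_neg (by omega)])
  have g0 := (k1 0 (by omega)).trans hs.reg_zero
  have g1 := (k1 1 (by omega)).trans hs.reg_one
  have g2 := (k1 2 (by omega)).trans hs.reg_two
  have g3 := (k1 3 (by omega)).trans hs.reg_three
  obtain ⟨s2, t2, x2, h2, hs2⟩ := exec_nextRound (b := I.bestIndex) (l := I.len) (M := I.writeMem (i + 1))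
    (s := (s1.setReg 6 (Op.add.eval (s1.reg 2) (s1.reg 3))).setMem (I.len + i)
      ((s1.setReg 6 (Op.add.eval (s1.reg 2) (s1.reg 3))).reg 5)) I.bitLen_n_le hi
    (by simp [State.setReg, State.setMem, g0]) (by simp [State.setReg, State.setMem, g1])
    (by simp [State.setReg, State.setMem, g2]) (by simp [State.setReg, State.setMem, g3]) (by
      funext p
      simp only [State.setReg, State.setMem, m1, hs.mem_eq, Function.update, r1]
      rw [writeMem, writeMem]
      by_cases hp : p = I.len + i
      · subst hp
        simp
      · have : (I.len ≤ p ∧ p < I.len + (i + 1)) ↔ (I.len ≤ p ∧ p < I.len + i) := by omega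
        simp only [this, hp, dite_false])
  refine ⟨s2, _, x1.seq <| (Exec.arith s1 .add 6 2 3).seq <| (Exec.store _ 6 5 (I.len + i) (by
    simp [State.setReg, Op.eval, g2, g3])).seq x2, ?_, hs2⟩
  have c1 := I.bitLen_len_add_le hi
  have c2 := e3.1
  simp [State.setReg, Op.cost, g2, g3, r1]
  set J := (candT (var 1) (var 3)).deg
  have p1 : I.timeBase ^ J ≤ I.timeBase ^ (J + 2) := Nat.pow_le_pow_right (by omega) (by omega)
  have p2 : I.timeBase ^ 2 ≤ I.timeBase ^ (J + 2) := Nat.pow_le_pow_right (by omega) (by omega)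
  have p3 : I.timeBase ^ (J + 3) = I.timeBase ^ (J + 2) * I.timeBase := pow_succ _ _
  nlinarith

theorem exec_copyBody {i : ℕ} (hi : i < I.n) {s : State}
    (hs : OutputState I.n I.bestIndex I.len i (I.copyMem i) s) :
    ∃ s' t, Exec copyBody s s' t ∧ t ≤ I.timeBase ^ ((candT (var 1) (var 3)).deg + 3) ∧
      OutputState I.n I.bestIndex I.len (i + 1) (I.copyMem (i + 1)) s' := by
  have hU := I.eight_le_timeBase
  have hil : bitLen i ≤ I.timeBase := I.bitLen_nat_le_of_len (hi.trans I.n_lt_len).le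
  have hl : bitLen I.len ≤ I.timeBase := I.bitLen_nat_le_of_len le_rfl
  -- As `n < len`, the copying overwrites the input but never the coordinates stored behind it.
  have hv : s.mem (I.len + i) = I.cand I.bestIndex i := by
    have := I.n_lt_len
    rw [hs.mem_eq, copyMem, if_neg (by omega), writeMem, if_pos (by omega)]
    simp
  have g0 := hs.reg_zero
  have g1 := hs.reg_one
  have g2 := hs.reg_two
  have g3 := hs.reg_three
  obtain ⟨s2, t2, x2, h2, hs2⟩ := exec_nextRound (b := I.bestIndex) (l := I.len) (M := I.copyMem (i + 1))
    (s := ((s.setReg 6 (Op.add.eval (s.reg 2) (s.reg 3))).setReg 5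
      ((s.setReg 6 (Op.add.eval (s.reg 2) (s.reg 3))).mem (I.len + i))).setMem i
      (((s.setReg 6 (Op.add.eval (s.reg 2) (s.reg 3))).setReg 5
      ((s.setReg 6 (Op.add.eval (s.reg 2) (s.reg 3))).mem (I.len + i))).reg 5)) I.bitLen_n_le hi
    (by simp [State.setReg, State.setMem, g0]) (by simp [State.setReg, State.setMem, g1])
    (by simp [State.setReg, State.setMem, g2]) (by simp [State.setReg, State.setMem, g3]) (by
      funext p
      simp only [State.setReg, State.setMem, Function.update_self, hv]
      rw [hs.mem_eq, Function.update_apply, copyMem, copyMem]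
      by_cases hp : p = i
      · subst hp
        simp
      · have : p < i + 1 ↔ p < i := by omega
        simp only [this, hp, if_false])
  refine ⟨s2, _, (Exec.arith s .add 6 2 3).seq <| (Exec.load _ 5 6 (I.len + i) (by
    simp [State.setReg, Op.eval, g2, g3])).seq <| (Exec.store _ 3 5 i (by
    simp [State.setReg, g3])).seq x2, ?_, hs2⟩
  have c1 := I.bitLen_len_add_le hi
  have c2 := I.bitLen_le_of_candBound (I.abs_cand_le I.bestIndex i)
  simp [State.setReg, Op.cost, g2, g3, hv]
  set J := (candT (var 1) (var 3)).deg
  have p2 : I.timeBase ^ 3 ≤ I.timeBase ^ (J + 3) := Nat.pow_le_pow_right (by omega) (by omega)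
  have p3 : 8 * 8 * I.timeBase ≤ I.timeBase ^ 3 := by
    rw [pow_succ, pow_two]
    gcongr
  omega

theorem exec_solver : ∃ D : ℕ, ∀ I : IQP, ∃ (s : State) (t : ℕ),
    Exec solver (init I.encode) s t ∧ t ≤ I.timeBase ^ D ∧
      ∀ i : Fin I.n, s.mem i = I.output i := by
  -- The degrees belong to fixed terms, so the exponent is chosen before the instance.
  refine ⟨nT.deg + bestT.deg + lenT.deg + (candT (var 1) (var 3)).deg + 6, fun I => ?_⟩
  have hU := I.eight_le_timeBase
  have hinit : I.Holds (init I.encode).mem := fun _ _ => rfl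
  obtain ⟨s1, t1, x1, h1, r1, m1, k1⟩ := (I.evals_n (d := 0) (ρ := fun _ => 0)).2 0 _ le_rfl
    (fun l hl => by omega) hinit
  obtain ⟨s2, t2, x2, h2, r2, m2, k2⟩ := (I.evals_best (d := 0) (ρ := fun _ => 0)).2 1 s1
    (by omega) (fun l hl => by omega) (m1 ▸ hinit)
  obtain ⟨s3, t3, x3, h3, r3, m3, k3⟩ := (I.evals_len (d := 0) (ρ := fun _ => 0)).2 2 s2
    (by omega) (fun l hl => by omega) (by rw [m2, m1]; exact hinit)
  have g0 : s3.reg 0 = I.n := ((k3 0 (by omega)).trans (k2 0 (by omega))).trans r1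
  have g1 : s3.reg 1 = I.bestIndex := (k3 1 (by omega)).trans r2
  obtain ⟨s4, t4, x4, h4, hs4⟩ := exec_output_loop (M := I.writeMem) (P := writeBody)
    I.bitLen_n_le (fun i hi s hs => I.exec_writeBody hi hs) I.n 0 (by omega)
    ((s3.setReg 3 0).setReg 4 (Op.sub.eval ((s3.setReg 3 0).reg 0) ((s3.setReg 3 0).reg 3)))
    ⟨by simp [State.setReg, g0], by simp [State.setReg, g1], by simp [State.setReg, r3],
      by simp [State.setReg], by simp [State.setReg, Op.eval, g0], by
      funext p
      simp only [State.setReg, m3, m2, m1]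
      rw [writeMem, if_neg (by omega)]
      rfl⟩
  obtain ⟨s5, t5, x5, h5, hs5⟩ := exec_output_loop (M := I.copyMem) (P := copyBody)
    I.bitLen_n_le (fun i hi s hs => I.exec_copyBody hi hs) I.n 0 (by omega)
    ((s4.setReg 3 0).setReg 4 (Op.sub.eval ((s4.setReg 3 0).reg 0) ((s4.setReg 3 0).reg 3)))
    ⟨by simp [State.setReg, hs4.reg_zero], by simp [State.setReg, hs4.reg_one],
      by simp [State.setReg, hs4.reg_two], by simp [State.setReg],
      by simp [State.setReg, Op.eval, hs4.reg_zero], by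
      funext p
      simp only [State.setReg, hs4.mem_eq]
      rw [copyMem, if_neg (by omega)]⟩
  refine ⟨s5, _, x1.seq <| x2.seq <| x3.seq <| (Exec.const s3 3 0).seq <|
    (Exec.arith _ .sub 4 0 3).seq <| x4.seq <| (Exec.const s4 3 0).seq <|
    (Exec.arith _ .sub 4 0 3).seq x5, ?_, fun i => ?_⟩
  · have c1 := I.bitLen_n_le
    have c2 := I.n_le
    simp [State.setReg, Op.cost, g0, hs4.reg_zero, bitLen_zero]
    generalize (candT (var 1) (var 3)).deg = J at *
    generalize nT.deg = p at *
    generalize bestT.deg = q at *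
    generalize lenT.deg = r at *
    generalize I.timeBase = U at *
    have p1 : U ^ p ≤ U ^ (p + q + r + J + 4) := Nat.pow_le_pow_right (by omega) (by omega)
    have p2 : U ^ q ≤ U ^ (p + q + r + J + 4) := Nat.pow_le_pow_right (by omega) (by omega)
    have p3 : U ^ r ≤ U ^ (p + q + r + J + 4) := Nat.pow_le_pow_right (by omega) (by omega)
    have p4 : U * U ^ (J + 3) ≤ U ^ (p + q + r + J + 4) := by
      rw [mul_comm, ← pow_succ]
      exact Nat.pow_le_pow_right (by omega) (by omega)
    have p5 : U ^ 2 ≤ U ^ (p + q + r + J + 4) := Nat.pow_le_pow_right (by omega) (by omega)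
    have p6 : I.n * (U + U ^ (J + 3)) ≤ U * (U + U ^ (J + 3)) := Nat.mul_le_mul_right _ c2
    have p7 : U ^ (p + q + r + J + 6) = U ^ (p + q + r + J + 4) * (U * U) := by
      rw [pow_add _ _ 2, pow_two]
    have p8 : 8 * U ≤ U * U := Nat.mul_le_mul_right _ hU
    rw [p7]
    generalize U ^ (p + q + r + J + 4) = Z at *
    nlinarith
  · rw [hs5.mem_eq, copyMem, if_pos i.2]
    rfl

end IQP

theorem theorem1 :
    ∃ (P : RAM.Prog) (f : ℕ → ℕ → ℕ) (c : ℕ), ∀ I : IQP,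
      ∃ (s : RAM.State) (t : ℕ) (x : Fin I.n → ℤ),
        RAM.Exec P (RAM.init I.encode) s t ∧
        t ≤ f I.n I.alpha * I.size ^ c ∧
        (∀ i : Fin I.n, s.mem i = x i) ∧
        ((∃ y : Fin I.n → ℤ, I.Feasible y) → I.Feasible x) ∧
        ((∃ y : Fin I.n → ℤ, I.Feasible y) → ¬ I.Unbounded → I.IsOptimal x) := by
  obtain ⟨D, hD⟩ := IQP.exec_solver
  -- The base `timeBase` is `20 * smallBound` times the input size, so its `D`-th power splits into
  -- `f` and a power of `L`.
  refine ⟨RAM.solver, fun n α => (20 * IQP.smallBound n (α ^ 2)) ^ D, D, fun I => ?_⟩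
  obtain ⟨s, t, hx, ht, hs⟩ := hD I
  exact ⟨s, t, I.output, hx, by rwa [← mul_pow], hs, I.feasible_output, I.isOptimal_output⟩
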